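/- A \emph{monoid variety} is a class of monoids closed under homomorphic images, submonoids and arbitrary direct products; monoid varieties are ordered by inclusion, and $\wedge$ denotes intersection. A \emph{monoid identity} $\mathbf{u}\approx\mathbf{v}$ is a pair of (possibly empty) words over a countably infinite set of variables; $[\![\Sigma]\!]$ denotes the variety of all monoids satisfying every identity in $\Sigma$. Let $\mathbf{B}_2^1$ and $\mathbf{A}_2^1$ be the monoids, under matrix multiplication, consisting of the six $2\times 2$ matrices $$\mathbf{B}_2^1:\ \begin{pmatrix}0&0\\0&0\end{pmatrix},\ \begin{pmatrix}1&0\\0&1\end{pmatrix},\ \begin{pmatrix}0&1\\0&0\end{pmatrix},\ \begin{pmatrix}0&0\\1&0\end{pmatrix},\ \begin{pmatrix}1&0\\0&0\end{pmatrix},\ \begin{pmatrix}0&0\\0&1\end{pmatrix},$$ $$\mathbf{A}_2^1:\ \begin{pmatrix}0&0\\0&0\end{pmatrix},\ \begin{pmatrix}1&0\\0&1\end{pmatrix},\ \begin{pmatrix}0&1\\0&0\end{pmatrix},\ \begin{pmatrix}1&0\\1&0\end{pmatrix},\ \begin{pmatrix}1&0\\0&0\end{pmatrix},\ \begin{pmatrix}0&1\\0&1\end{pmatrix},$$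 and let $\mathbb{B}_2^1$ and $\mathbb{A}_2^1$ be the monoid varieties generated by $\mathbf{B}_2^1$ and $\mathbf{A}_2^1$ respectively. (1) The interval $[\mathbb{B}_2^1,\ [\![x^2y^2\approx y^2x^2]\!]\wedge\mathbb{A}_2^1]$, that is, the set of all monoid varieties $\mathbb{V}$ with $\mathbb{B}_2^1\subseteq\mathbb{V}\subseteq[\![x^2y^2\approx y^2x^2]\!]\wedge\mathbb{A}_2^1$, has cardinality $2^{\aleph_0}$. (2) The variety $\mathbb{B}_2^1$ is not defined within $\mathbb{A}_2^1$ by any finite system of identities: there is no finite set $\Sigma$ of monoid identities with $[\![\Sigma]\!]\wedge\mathbb{A}_2^1=\mathbb{B}_2^1$. -/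

import Mathlib

open Cardinal

/-- A monoid variety: a class of monoids closed under homomorphic images, submonoids and
arbitrary direct products. -/
@[ext]
structure MonoidVariety where
  Mem : ∀ (M : Type) [Monoid M], Prop
  mem_of_surjective : ∀ (M N : Type) [Monoid M] [Monoid N] (f : M →* N),
    Function.Surjective f → Mem M → Mem N
  mem_submonoid : ∀ (M : Type) [Monoid M] (S : Submonoid M), Mem M → Mem S
  mem_pi : ∀ (ι : Type) (M : ι → Type) [∀ i, Monoid (M i)],
    (∀ i, Mem (M i)) → Mem (∀ i, M i)

namespace MonoidVariety

/-- Monoid varieties are ordered by inclusion; the meet is the intersection. -/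
instance : SemilatticeInf MonoidVariety where
  le V W := ∀ (M : Type) [Monoid M], V.Mem M → W.Mem M
  le_refl _ _ _ h := h
  le_trans _ _ _ h₁ h₂ M _ h := h₂ M (h₁ M h)
  le_antisymm V W h₁ h₂ := by
    ext M inst
    exact ⟨h₁ M, h₂ M⟩
  inf V W :=
    { Mem := fun M _ => V.Mem M ∧ W.Mem M
      mem_of_surjective := fun M N _ _ f hf h =>
        ⟨V.mem_of_surjective M N f hf h.1, W.mem_of_surjective M N f hf h.2⟩
      mem_submonoid := fun M _ S h => ⟨V.mem_submonoid M S h.1, W.mem_submonoid M S h.2⟩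
      mem_pi := fun ι M _ h =>
        ⟨V.mem_pi ι M fun i => (h i).1, W.mem_pi ι M fun i => (h i).2⟩ }
  inf_le_left _ _ _ _ h := h.1
  inf_le_right _ _ _ _ h := h.2
  le_inf _ _ _ h₁ h₂ M _ h := ⟨h₁ M h, h₂ M h⟩

/-- The monoid variety generated by a monoid `G`: the class of the monoids that lie in every
variety containing `G`. -/
def generatedBy (G : Type) [Monoid G] : MonoidVariety where
  Mem M _ := ∀ V : MonoidVariety, V.Mem G → V.Mem M
  mem_of_surjective M N _ _ f hf h V hV := V.mem_of_surjective M N f hf (h V hV)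
  mem_submonoid M _ S h V hV := V.mem_submonoid M S (h V hV)
  mem_pi ι M _ h V hV := V.mem_pi ι M fun i => h i V hV

end MonoidVariety

/-- A monoid identity `u ≈ v`: a pair of (possibly empty) words over the countably infinite
set of variables `ℕ`. -/
abbrev MonoidIdentity : Type := FreeMonoid ℕ × FreeMonoid ℕ

/-- `M ⊨ u ≈ v`: both words take the same value in `M` under every assignment of elements of
`M` to the variables. -/
def MonoidIdentity.HoldsIn (p : MonoidIdentity) (M : Type) [Monoid M] : Prop :=
  ∀ θ : ℕ → M, FreeMonoid.lift θ p.1 = FreeMonoid.lift θ p.2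

/-- The monoid variety `⟦Γ⟧` of all monoids that satisfy every identity in the set `Γ`. -/
def MonoidVariety.definedBy (Γ : Set MonoidIdentity) : MonoidVariety where
  Mem M _ := ∀ p ∈ Γ, p.HoldsIn M
  mem_of_surjective M N _ _ f hf h p hp θ := by
    choose g hg using hf
    have key : ∀ w : FreeMonoid ℕ,
        FreeMonoid.lift θ w = f (FreeMonoid.lift (fun i => g (θ i)) w) := by
      intro w
      rw [← MonoidHom.comp_apply, FreeMonoid.comp_lift]
      have : f ∘ (fun i => g (θ i)) = θ := by
        funext i
        exact hg (θ i)
      rw [this]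
    rw [key, key, h p hp]
  mem_submonoid M _ S h p hp θ := by
    have key : ∀ w : FreeMonoid ℕ,
        ((FreeMonoid.lift θ w : S) : M) = FreeMonoid.lift (fun i => (θ i : M)) w := by
      intro w
      rw [← Submonoid.subtype_apply, ← MonoidHom.comp_apply, FreeMonoid.comp_lift]
      rfl
    apply Subtype.ext
    rw [key, key, h p hp]
  mem_pi ι M _ h p hp θ := by
    have key : ∀ (i : ι) (w : FreeMonoid ℕ),
        (FreeMonoid.lift θ w) i = FreeMonoid.lift (fun k => θ k i) w := by
      intro i w
      change ((Pi.evalMonoidHom M i).comp (FreeMonoid.lift θ)) w = _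
      rw [FreeMonoid.comp_lift]
      rfl
    funext i
    rw [key, key, h i p hp]

/-- The six-element Brandt monoid `B₂¹`, with elements `0, 1, a, b, ab, ba`. -/
def BrandtMonoid : Submonoid (Matrix (Fin 2) (Fin 2) ℤ) where
  carrier := {!![0, 0; 0, 0], !![1, 0; 0, 1], !![0, 1; 0, 0], !![0, 0; 1, 0],
    !![1, 0; 0, 0], !![0, 0; 0, 1]}
  one_mem' := by simp [Matrix.one_fin_two]
  mul_mem' := by
    intro x y hx hy
    simp only [Set.mem_insert_iff, Set.mem_singleton_iff] at hx hy ⊢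
    rcases hx with rfl | rfl | rfl | rfl | rfl | rfl <;>
    rcases hy with rfl | rfl | rfl | rfl | rfl | rfl <;>
    decide

/-- The six-element monoid `A₂¹`, with elements `0, 1, c, d, cd, dc`. -/
def ATwoOneMonoid : Submonoid (Matrix (Fin 2) (Fin 2) ℤ) where
  carrier := {!![0, 0; 0, 0], !![1, 0; 0, 1], !![0, 1; 0, 0], !![1, 0; 1, 0],
    !![1, 0; 0, 0], !![0, 1; 0, 1]}
  one_mem' := by simp [Matrix.one_fin_two]
  mul_mem' := by
    intro x y hx hy
    simp only [Set.mem_insert_iff, Set.mem_singleton_iff] at hx hy ⊢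
    rcases hx with rfl | rfl | rfl | rfl | rfl | rfl <;>
    rcases hy with rfl | rfl | rfl | rfl | rfl | rfl <;>
    decide

/-- `𝔹₂¹`, the monoid variety generated by `B₂¹`. -/
def varietyB : MonoidVariety := MonoidVariety.generatedBy BrandtMonoid

/-- `𝔸₂¹`, the monoid variety generated by `A₂¹`. -/
def varietyA : MonoidVariety := MonoidVariety.generatedBy ATwoOneMonoid

/-- The identity `x²y² ≈ y²x²`, with `x`, `y` the variables `0`, `1`. -/
def squaresCommute : MonoidIdentity :=
  (FreeMonoid.of 0 ^ 2 * FreeMonoid.of 1 ^ 2, FreeMonoid.of 1 ^ 2 * FreeMonoid.of 0 ^ 2)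

/-!
The proof encodes odd cycles into words, in three kinds of letters `a`, `x i` and `t k`. The word
`cycleWord n` is the product of the blocks `a xᵢ xⱼ a` and `a xⱼ xᵢ a` for the edges `{i, j}` of the
cycle of length `n`, and of a last block `a`, where each block is followed by a letter `t k` of its
own. The identity `cycleIdentity n` replaces the last block `a` by `a a`.

* If `n` is odd, then this identity holds in `B₂¹` (`sameValue_cycleWord`). When the value of `a` is
  not idempotent, `a xᵢ xⱼ a` and `a xⱼ xᵢ a` are both nonzero only if exactly one of `xᵢ`, `xⱼ` has
  the value `1`; around an odd cycle this is impossible, so both sides are zero.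
* The word is determined by its values in `A₂¹` (`eq_blockWord_of_aTwoOneMonoid`). Hence its
  syntactic monoid `CycleMonoid n` lies in the variety of `A₂¹` by Birkhoff's theorem, and it violates
  `cycleIdentity n`. As `A₂¹` satisfies `x² ≈ x³`, the word is square-free, and so `CycleMonoid n`
  satisfies `x² y² ≈ y² x²`.
* `CycleMonoid n` satisfies every identity of `B₂¹` that is short in comparison with `n`
  (`eq_cycleWord_of_short`). An application of such an identity to the word leaves the blocks of some
  edge uncut. When these blocks are deleted, the remaining edges form a path; a two-colouring of this
  path gives assignments in `B₂¹` under which the word is nonzero, and these determine it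
  (`eq_blockWord_of_colouring`).

The last fact shows that no finite set of identities defines the variety of `B₂¹` within that of
`A₂¹`. It also shows that the identities of a sequence of rapidly growing odd cycles are independent,
so that their subsets define a continuum of varieties in the interval. There are no more than that,
since a variety is determined by its identities.

That a word `w` is determined by its values is shown by looking at the first place where another
word differs from it. The elements of `B₂¹` and `A₂¹` act on row vectors as partial maps of two
states, and one finds an assignment under which `w` can be read from some state, while the other word
gets stuck at the first difference. Since each `t k` occurs only once, its arrow can be adapted to
the blocks around it, so that only the single blocks matter (`exists_separators`).
-/

/-! ### Birkhoff's theorem -/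

namespace MonoidVariety

/-- Birkhoff's theorem. The monoid `M` is a quotient of a submonoid of the product of all quotients
of `FreeMonoid M` that lie in `V`. -/
theorem mem_of_forall_holdsIn (V : MonoidVariety) (M : Type) [Monoid M]
    (h : ∀ p : MonoidIdentity, (∀ (N : Type) [Monoid N], V.Mem N → p.HoldsIn N) → p.HoldsIn M) :
    V.Mem M := by
  classical
  let ι : Type := {c : Con (FreeMonoid M) // V.Mem c.Quotient}
  let π : FreeMonoid M →* ∀ c : ι, c.1.Quotient := MonoidHom.pi fun c => c.1.mk'
  have hπ : V.Mem (MonoidHom.mrange π) := V.mem_submonoid _ _ (V.mem_pi ι _ fun c => c.2)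
  have key : ∀ w w' : FreeMonoid M, π w = π w' →
      FreeMonoid.lift (id : M → M) w = FreeMonoid.lift (id : M → M) w' := by
    intro w w' hw
    -- only finitely many elements of `M` occur in `w` and `w'`, so they can be renamed as variables
    let l : List M := w.toList ++ w'.toList
    let g : M → ℕ := fun m => l.idxOf m
    let θ : ℕ → M := fun k => l.getD k 1
    have hθ : ∀ m ∈ l, θ (g m) = m := by
      intro m hm
      have := List.idxOf_lt_length_of_mem hm
      simp only [θ, g]
      rw [List.getD_eq_getElem _ _ this, List.getElem_idxOf]
    have hid : ∀ z : FreeMonoid M, (∀ m ∈ z.toList, m ∈ l) →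
        FreeMonoid.lift θ (FreeMonoid.map g z) = FreeMonoid.lift (id : M → M) z := by
      intro z hz
      rw [FreeMonoid.lift_apply, FreeMonoid.lift_apply, FreeMonoid.toList_map, List.map_map]
      congr 1
      apply List.map_congr_left
      intro m hm
      exact hθ m (hz m hm)
    have hp := h (FreeMonoid.map g w, FreeMonoid.map g w') (by
      intro N _ hN θ'
      let ψ : FreeMonoid M →* N := (FreeMonoid.lift θ').comp (FreeMonoid.map g)
      have hk : V.Mem (Con.ker ψ).Quotient :=
        V.mem_of_surjective _ _ (Con.quotientKerEquivRange ψ).symm.toMonoidHom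
          (Con.quotientKerEquivRange ψ).symm.surjective (V.mem_submonoid _ _ hN)
      have := congrFun hw ⟨Con.ker ψ, hk⟩
      exact (Con.eq _).1 this) θ
    rw [hid, hid] at hp
    · exact hp
    · intro m hm
      exact List.mem_append_right _ hm
    · intro m hm
      exact List.mem_append_left _ hm
  let κ : Con (FreeMonoid M) := Con.ker π
  let f : κ.Quotient →* M := Con.lift κ (FreeMonoid.lift (id : M → M)) key
  refine V.mem_of_surjective _ _ f ?_ (V.mem_of_surjective _ _
    (Con.quotientKerEquivRange π).symm.toMonoidHom (Con.quotientKerEquivRange π).symm.surjective hπ)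
  intro m
  exact ⟨κ.mk' (FreeMonoid.of m), FreeMonoid.lift_eval_of _ _⟩

theorem mem_generatedBy_self (G : Type) [Monoid G] : (generatedBy G).Mem G := fun _ h => h

theorem mem_generatedBy_of_holdsIn {G M : Type} [Monoid G] [Monoid M]
    (h : ∀ p : MonoidIdentity, p.HoldsIn G → p.HoldsIn M) : (generatedBy G).Mem M :=
  mem_of_forall_holdsIn _ _ fun p hp => h p (hp G (mem_generatedBy_self G))

theorem holdsIn_of_mem_generatedBy {G M : Type} [Monoid G] [Monoid M]
    (hM : (generatedBy G).Mem M) {p : MonoidIdentity} (hp : p.HoldsIn G) : p.HoldsIn M :=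
  hM (definedBy {p}) (by rintro q rfl; exact hp) p rfl

theorem generatedBy_le {G : Type} [Monoid G] {V : MonoidVariety} (h : V.Mem G) :
    generatedBy G ≤ V := fun _ _ hM => hM V h

/-- The identities that hold in every member of a variety. -/
def identities (V : MonoidVariety) : Set MonoidIdentity :=
  {p | ∀ (N : Type) [Monoid N], V.Mem N → p.HoldsIn N}

theorem identities_injective : Function.Injective identities := by
  intro V W h
  apply le_antisymm
  · intro M _ hM
    exact W.mem_of_forall_holdsIn M fun p hp => (h ▸ hp : p ∈ V.identities) M hM
  · intro M _ hM
    exact V.mem_of_forall_holdsIn M fun p hp => (h ▸ hp : p ∈ W.identities) M hM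

theorem mk_le_continuum : #MonoidVariety ≤ 𝔠 := by
  have h := Cardinal.lift_mk_le_lift_mk_of_injective identities_injective
  have h2 : #(Set MonoidIdentity) = 𝔠 := by
    rw [Cardinal.mk_set, Cardinal.mk_eq_aleph0, Cardinal.two_power_aleph0]
  rw [h2] at h
  simpa using h

end MonoidVariety

/-! ### The variety of `B₂¹` is contained in the variety of `A₂¹` -/

/-- The matrix analogue of the division of `B₂` by `A₂ × A₂`: the generators `a`, `b` of `B₂¹` are
related to the pairs `(c, d)`, `(d, c)`, and `0` is related to the pairs with a zero component. -/
def divisionRelation : Submonoid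
    ((Matrix (Fin 2) (Fin 2) ℤ × Matrix (Fin 2) (Fin 2) ℤ) × Matrix (Fin 2) (Fin 2) ℤ) where
  carrier := {X | X ∈ ({((!![1, 0; 0, 1], !![1, 0; 0, 1]), !![1, 0; 0, 1]),
      ((!![0, 1; 0, 0], !![1, 0; 1, 0]), !![0, 1; 0, 0]),
      ((!![1, 0; 1, 0], !![0, 1; 0, 0]), !![0, 0; 1, 0]),
      ((!![1, 0; 0, 0], !![0, 1; 0, 1]), !![1, 0; 0, 0]),
      ((!![0, 1; 0, 1], !![1, 0; 0, 0]), !![0, 0; 0, 1])} : Set _) ∨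
    ((X.1.1 = 0 ∨ X.1.2 = 0) ∧ X.2 = 0)}
  one_mem' := by
    left; left; simp [Matrix.one_fin_two, Prod.ext_iff]
  mul_mem' := by
    rintro ⟨⟨x, x'⟩, y⟩ ⟨⟨z, z'⟩, w⟩ hx hz
    rcases hx with hx | ⟨hx, hy⟩
    · rcases hz with hz | ⟨hz, hw⟩
      · simp only [Set.mem_insert_iff, Set.mem_singleton_iff, Prod.mk.injEq, Set.mem_ofPred_eq,
          Prod.mk_mul_mk] at hx hz ⊢
        rcases hx with ⟨⟨rfl, rfl⟩, rfl⟩ | ⟨⟨rfl, rfl⟩, rfl⟩ | ⟨⟨rfl, rfl⟩, rfl⟩ |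
          ⟨⟨rfl, rfl⟩, rfl⟩ | ⟨⟨rfl, rfl⟩, rfl⟩ <;>
        rcases hz with ⟨⟨rfl, rfl⟩, rfl⟩ | ⟨⟨rfl, rfl⟩, rfl⟩ | ⟨⟨rfl, rfl⟩, rfl⟩ |
          ⟨⟨rfl, rfl⟩, rfl⟩ | ⟨⟨rfl, rfl⟩, rfl⟩ <;>
        decide
      · right
        simp only at hz hw
        subst hw
        rcases hz with rfl | rfl <;> simp
    · right
      simp only at hx hy
      subst hy
      rcases hx with rfl | rfl <;> simp

theorem eq_of_mem_divisionRelation {X : Matrix (Fin 2) (Fin 2) ℤ × Matrix (Fin 2) (Fin 2) ℤ}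
    {y z : Matrix (Fin 2) (Fin 2) ℤ} (hy : (X, y) ∈ divisionRelation)
    (hz : (X, z) ∈ divisionRelation) : y = z := by
  obtain ⟨x, x'⟩ := X
  rcases hy with hy | ⟨hy, rfl⟩ <;> rcases hz with hz | ⟨hz, rfl⟩
  · simp only [Set.mem_insert_iff, Set.mem_singleton_iff, Prod.mk.injEq] at hy hz
    rcases hy with ⟨⟨rfl, rfl⟩, rfl⟩ | ⟨⟨rfl, rfl⟩, rfl⟩ | ⟨⟨rfl, rfl⟩, rfl⟩ |
      ⟨⟨rfl, rfl⟩, rfl⟩ | ⟨⟨rfl, rfl⟩, rfl⟩ <;>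
    revert hz <;> simp +contextual [← Matrix.ext_iff, Fin.forall_fin_two]
  · simp only [Set.mem_insert_iff, Set.mem_singleton_iff, Prod.mk.injEq] at hy hz
    rcases hy with ⟨⟨rfl, rfl⟩, rfl⟩ | ⟨⟨rfl, rfl⟩, rfl⟩ | ⟨⟨rfl, rfl⟩, rfl⟩ |
      ⟨⟨rfl, rfl⟩, rfl⟩ | ⟨⟨rfl, rfl⟩, rfl⟩ <;>
    revert hz <;> decide
  · simp only [Set.mem_insert_iff, Set.mem_singleton_iff, Prod.mk.injEq] at hy hz
    rcases hz with ⟨⟨rfl, rfl⟩, rfl⟩ | ⟨⟨rfl, rfl⟩, rfl⟩ | ⟨⟨rfl, rfl⟩, rfl⟩ |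
      ⟨⟨rfl, rfl⟩, rfl⟩ | ⟨⟨rfl, rfl⟩, rfl⟩ <;>
    revert hy <;> decide
  · rfl

theorem exists_mem_divisionRelation (y : BrandtMonoid) :
    ∃ x x' : ATwoOneMonoid, (((x : Matrix (Fin 2) (Fin 2) ℤ), (x' : Matrix (Fin 2) (Fin 2) ℤ)),
      (y : Matrix (Fin 2) (Fin 2) ℤ)) ∈ divisionRelation := by
  obtain ⟨y, rfl | rfl | rfl | rfl | rfl | rfl⟩ := y
  · exact ⟨⟨!![0, 0; 0, 0], by simp [ATwoOneMonoid]⟩, ⟨!![0, 0; 0, 0], by simp [ATwoOneMonoid]⟩,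
      Or.inr (by decide)⟩
  · exact ⟨⟨!![1, 0; 0, 1], by simp [ATwoOneMonoid]⟩, ⟨!![1, 0; 0, 1], by simp [ATwoOneMonoid]⟩,
      Or.inl (by simp)⟩
  · exact ⟨⟨!![0, 1; 0, 0], by simp [ATwoOneMonoid]⟩, ⟨!![1, 0; 1, 0], by simp [ATwoOneMonoid]⟩,
      Or.inl (by simp)⟩
  · exact ⟨⟨!![1, 0; 1, 0], by simp [ATwoOneMonoid]⟩, ⟨!![0, 1; 0, 0], by simp [ATwoOneMonoid]⟩,
      Or.inl (by simp)⟩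
  · exact ⟨⟨!![1, 0; 0, 0], by simp [ATwoOneMonoid]⟩, ⟨!![0, 1; 0, 1], by simp [ATwoOneMonoid]⟩,
      Or.inl (by simp)⟩
  · exact ⟨⟨!![0, 1; 0, 1], by simp [ATwoOneMonoid]⟩, ⟨!![1, 0; 0, 0], by simp [ATwoOneMonoid]⟩,
      Or.inl (by simp)⟩

theorem lift_eq_brandtMonoid_of_aTwoOneMonoid {β : Type*} {u v : FreeMonoid β}
    (h : ∀ θ : β → ATwoOneMonoid, FreeMonoid.lift θ u = FreeMonoid.lift θ v)
    (θ : β → BrandtMonoid) : FreeMonoid.lift θ u = FreeMonoid.lift θ v := by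
  choose θ₁ θ₂ hθ using fun i => exists_mem_divisionRelation (θ i)
  have key : ∀ w : FreeMonoid β, (((FreeMonoid.lift θ₁ w : Matrix (Fin 2) (Fin 2) ℤ),
      (FreeMonoid.lift θ₂ w : Matrix (Fin 2) (Fin 2) ℤ)),
      (FreeMonoid.lift θ w : Matrix (Fin 2) (Fin 2) ℤ)) ∈ divisionRelation := by
    intro w
    induction w using FreeMonoid.inductionOn' with
    | one => exact divisionRelation.one_mem
    | of_mul i w ih =>
      simp only [map_mul, FreeMonoid.lift_eval_of, Submonoid.coe_mul]
      exact divisionRelation.mul_mem (hθ i) ih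
  apply Subtype.ext
  have h₁ := key u
  have h₂ := key v
  rw [h θ₁, h θ₂] at h₁
  exact eq_of_mem_divisionRelation h₁ h₂

theorem varietyB_le_varietyA : varietyB ≤ varietyA :=
  MonoidVariety.generatedBy_le
    (MonoidVariety.mem_generatedBy_of_holdsIn fun _ => lift_eq_brandtMonoid_of_aTwoOneMonoid)

theorem ATwoOneMonoid.sq_eq_cube (x : ATwoOneMonoid) : x * x = x * x * x := by
  obtain ⟨x, rfl | rfl | rfl | rfl | rfl | rfl⟩ := x <;> exact Subtype.ext (by decide)

theorem BrandtMonoid.sq_mul_sq (x y : BrandtMonoid) : x ^ 2 * y ^ 2 = y ^ 2 * x ^ 2 := by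
  obtain ⟨x, rfl | rfl | rfl | rfl | rfl | rfl⟩ := x <;>
  obtain ⟨y, rfl | rfl | rfl | rfl | rfl | rfl⟩ := y <;> exact Subtype.ext (by decide)

/-- In `B₂¹` only the identity and one nonidempotent element can be placed between two copies of a
nonidempotent element in both orders without getting zero. -/
theorem BrandtMonoid.eq_one_iff_ne_one {a x y : BrandtMonoid} (ha : a * a ≠ a)
    (h₁ : (a * x * y * a : BrandtMonoid) ≠ ⟨!![0, 0; 0, 0], by simp [BrandtMonoid]⟩)
    (h₂ : (a * y * x * a : BrandtMonoid) ≠ ⟨!![0, 0; 0, 0], by simp [BrandtMonoid]⟩) :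
    x = 1 ↔ y ≠ 1 := by
  revert ha h₁ h₂
  obtain ⟨a, rfl | rfl | rfl | rfl | rfl | rfl⟩ := a <;>
  obtain ⟨x, rfl | rfl | rfl | rfl | rfl | rfl⟩ := x <;>
  obtain ⟨y, rfl | rfl | rfl | rfl | rfl | rfl⟩ := y <;>
  simp only [Subtype.ext_iff, Submonoid.coe_mul, Submonoid.coe_one, ne_eq] <;> decide

/-! ### Words as sequences of partial maps -/

/-- The letters of the words under consideration. Each `t k` occurs at most once in a block word. -/
inductive Letter
  | a
  | x (i : ℕ)
  | t (k : ℕ)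
  deriving DecidableEq

open Letter

/-- The words `u` and `v` take the same value in `S` under every assignment. -/
def SameValue (S : Submonoid (Matrix (Fin 2) (Fin 2) ℤ)) (u v : List Letter) : Prop :=
  ∀ φ : Letter → S, (u.map φ).prod = (v.map φ).prod

theorem SameValue.append_right {S : Submonoid (Matrix (Fin 2) (Fin 2) ℤ)} {u v : List Letter}
    (h : SameValue S u v) (w : List Letter) : SameValue S (u ++ w) (v ++ w) := by
  intro φ
  simp [h φ]

/-- A partial map on a set of two states. -/
abbrev PartialMap : Type := Fin 2 → Option (Fin 2)

namespace PartialMap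

/-- The matrix of a partial map, for the action on row vectors from the right. -/
def toMatrix (f : PartialMap) : Matrix (Fin 2) (Fin 2) ℤ :=
  Matrix.of fun i j => if f i = some j then 1 else 0

/-- The partial map whose only arrow is `s → e`. -/
def edge (s e : Fin 2) : PartialMap := fun q => if q = s then some e else none

/-- The partial map that sends both states to `e`. -/
def reset (e : Fin 2) : PartialMap := fun _ => some e

theorem edge_self (s e : Fin 2) : edge s e s = some e := if_pos rfl

theorem edge_eq_some {s e q r : Fin 2} : edge s e q = some r ↔ q = s ∧ e = r := by
  unfold edge; split_ifs with h <;> simp [h]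

theorem toMatrix_injective : Function.Injective toMatrix := by
  intro f g h
  funext i
  have h' : ∀ j, (f i = some j ↔ g i = some j) := by
    intro j
    have := congrFun (congrFun h i) j
    simp only [toMatrix, Matrix.of_apply] at this
    split_ifs at this <;> simp_all
  exact Option.ext h'

theorem toMatrix_comp (f g : PartialMap) :
    toMatrix (fun q => (f q).bind g) = toMatrix f * toMatrix g := by
  ext i j
  simp only [Matrix.mul_apply, toMatrix, Matrix.of_apply, Fin.sum_univ_two]
  obtain h | ⟨q, h⟩ : f i = none ∨ ∃ q, f i = some q := by
    cases f i <;> simp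
  · simp [h]
  · fin_cases q <;> simp [h]

theorem toMatrix_some : toMatrix some = 1 := by
  ext i j; simp [toMatrix, Matrix.one_apply]

theorem toMatrix_edge_mem_brandtMonoid (s e : Fin 2) : toMatrix (edge s e) ∈ BrandtMonoid := by
  have : toMatrix (edge s e) ∈ ({!![0, 0; 0, 0], !![1, 0; 0, 1], !![0, 1; 0, 0], !![0, 0; 1, 0],
    !![1, 0; 0, 0], !![0, 0; 0, 1]} : Set (Matrix (Fin 2) (Fin 2) ℤ)) := by
    revert s e
    simp only [Set.mem_insert_iff, Set.mem_singleton_iff]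
    decide
  exact this

theorem toMatrix_edge_mem_aTwoOneMonoid (e : Fin 2) : toMatrix (edge 0 e) ∈ ATwoOneMonoid := by
  have : toMatrix (edge 0 e) ∈ ({!![0, 0; 0, 0], !![1, 0; 0, 1], !![0, 1; 0, 0], !![1, 0; 1, 0],
    !![1, 0; 0, 0], !![0, 1; 0, 1]} : Set (Matrix (Fin 2) (Fin 2) ℤ)) := by
    revert e
    simp only [Set.mem_insert_iff, Set.mem_singleton_iff]
    decide
  exact this

theorem toMatrix_reset_mem_aTwoOneMonoid (e : Fin 2) : toMatrix (reset e) ∈ ATwoOneMonoid := by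
  have : toMatrix (reset e) ∈ ({!![0, 0; 0, 0], !![1, 0; 0, 1], !![0, 1; 0, 0], !![1, 0; 1, 0],
    !![1, 0; 0, 0], !![0, 1; 0, 1]} : Set (Matrix (Fin 2) (Fin 2) ℤ)) := by
    revert e
    simp only [Set.mem_insert_iff, Set.mem_singleton_iff]
    decide
  exact this

end PartialMap

open PartialMap

/-- The partial map computed by a word when its letters act as partial maps, read from the left. -/
def run (α : Letter → PartialMap) : List Letter → PartialMap
  | [] => some
  | y :: w => fun q => (α y q).bind (run α w)

@[simp] theorem run_nil (α : Letter → PartialMap) (q : Fin 2) : run α [] q = some q := rfl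

@[simp] theorem run_cons (α : Letter → PartialMap) (y : Letter) (w : List Letter) (q : Fin 2) :
    run α (y :: w) q = (α y q).bind (run α w) := rfl

theorem run_append (α : Letter → PartialMap) (v w : List Letter) (q : Fin 2) :
    run α (v ++ w) q = (run α v q).bind (run α w) := by
  induction v generalizing q with
  | nil => simp
  | cons y v ih =>
    simp only [List.cons_append, run_cons]
    rcases α y q with _ | r
    · rfl
    · simp [ih]

theorem run_congr {α β : Letter → PartialMap} {w : List Letter} (h : ∀ y ∈ w, α y = β y) :
    run α w = run β w := by
  induction w with
  | nil => rfl
  | cons y w ih =>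
    funext q
    simp only [run_cons]
    rw [h y (by simp), ih fun z hz => h z (by simp [hz])]

theorem toMatrix_run (α : Letter → PartialMap) (w : List Letter) :
    toMatrix (run α w) = (w.map fun y => toMatrix (α y)).prod := by
  induction w with
  | nil => exact toMatrix_some
  | cons y w ih =>
    rw [List.map_cons, List.prod_cons, ← ih, ← toMatrix_comp]
    rfl

theorem SameValue.run_eq {S : Submonoid (Matrix (Fin 2) (Fin 2) ℤ)} {u v : List Letter}
    (h : SameValue S u v) {α : Letter → PartialMap} (hα : ∀ y, toMatrix (α y) ∈ S) :
    run α u = run α v := by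
  apply toMatrix_injective
  have key : ∀ w : List Letter, ((w.map fun y => (⟨_, hα y⟩ : S)).prod : S).1 =
      toMatrix (run α w) := by
    intro w
    rw [toMatrix_run, ← Submonoid.subtype_apply, map_list_prod, List.map_map]
    rfl
  rw [← key, ← key, h]

/-! ### Block words -/

/-- The word `b 0 · t 0 · b 1 · t 1 ⋯ b (m - 1) · t (m - 1)`. -/
def blockWord (b : ℕ → List Letter) : ℕ → List Letter
  | 0 => []
  | m + 1 => blockWord b m ++ (b m ++ [t m])

/-- The words allowed as blocks: `1`, `a`, and `a xᵢ xⱼ a` with `i ≠ j`. -/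
inductive IsBlock : List Letter → Prop
  | nil : IsBlock []
  | single : IsBlock [a]
  | pair {i j : ℕ} (h : i ≠ j) : IsBlock [a, x i, x j, a]

theorem IsBlock.t_notMem {B : List Letter} (h : IsBlock B) (k : ℕ) : t k ∉ B := by
  cases h <;> simp

theorem blockWord_eq_append {b : ℕ → List Letter} {m : ℕ} {P Q : List Letter} {y : Letter}
    (h : blockWord b m = P ++ y :: Q) : ∃ k < m, ∃ B₁ B₂ R, b k = B₁ ++ B₂ ∧
      P = blockWord b k ++ B₁ ∧ y :: Q = B₂ ++ t k :: R := by
  induction m generalizing Q with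
  | zero => simp [blockWord] at h
  | succ m ih =>
    simp only [blockWord] at h
    rcases List.append_eq_append_iff.1 h with ⟨C, hP, hC⟩ | ⟨C, hm, hC⟩
    · rcases List.append_eq_append_iff.1 hC with ⟨D, hD, hD'⟩ | ⟨D, hD, hD'⟩
      · -- the prefix ends after the last block
        rcases D with _ | ⟨d, D⟩
        · exact ⟨m, by omega, b m, [], [], by simp, by simp [hP, hD], by simp_all⟩
        · simp at hD'
      · exact ⟨m, by omega, C, D, [], hD, hP, by simp [hD']⟩
    · rcases C with _ | ⟨c, C⟩
      · refine ⟨m, by omega, [], b m, [], by simp, by simp_all, by simp_all⟩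
      · simp only [List.cons_append, List.cons.injEq] at hC
        obtain ⟨rfl, rfl⟩ := hC
        obtain ⟨k, hk, B₁, B₂, R, h₁, h₂, h₃⟩ := ih hm
        refine ⟨k, by omega, B₁, B₂, R ++ (b m ++ [t m]), h₁, h₂, ?_⟩
        rw [← List.cons_append, h₃]
        simp

theorem t_mem_blockWord {b : ℕ → List Letter} (hb : ∀ k, IsBlock (b k)) {m k : ℕ} :
    t k ∈ blockWord b m ↔ k < m := by
  induction m with
  | zero => simp [blockWord]
  | succ m ih =>
    simp only [blockWord, List.mem_append, ih, (hb m).t_notMem, List.mem_singleton, Letter.t.injEq, false_or]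
    omega

theorem run_blockWord {α : Letter → PartialMap} {b : ℕ → List Letter} {σ : ℕ → Fin 2}
    (hσ : ∀ j, run α (b j ++ [t j]) (σ j) = some (σ (j + 1))) (m : ℕ) :
    run α (blockWord b m) (σ 0) = some (σ m) := by
  induction m with
  | zero => rfl
  | succ m ih => rw [blockWord, run_append, ih]; exact hσ m

/-- If a block word can be read under an assignment, then so can every prefix of a word with the
same value. -/
theorem SameValue.run_prefix_ne_none {S : Submonoid (Matrix (Fin 2) (Fin 2) ℤ)}
    {b : ℕ → List Letter} {m k : ℕ} {B Q w : List Letter}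
    (h : SameValue S (blockWord b m) w) (hw : w = blockWord b k ++ B ++ Q)
    {α : Letter → PartialMap} (hα : ∀ y, toMatrix (α y) ∈ S) {σ : ℕ → Fin 2}
    (hσ : ∀ j, run α (b j ++ [t j]) (σ j) = some (σ (j + 1))) : run α B (σ k) ≠ none := by
  intro hB
  have h₁ := congrFun (h.run_eq hα) (σ 0)
  rw [run_blockWord hσ, hw, run_append, run_append, run_blockWord hσ] at h₁
  simp [hB] at h₁

theorem List.eq_or_exists_mismatch {β : Type*} (u v : List β) :
    u = v ∨ (∃ y s, v = u ++ y :: s) ∨ (∃ y s, u = v ++ y :: s) ∨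
      ∃ p y s y' s', u = p ++ y :: s ∧ v = p ++ y' :: s' ∧ y ≠ y' := by
  induction u generalizing v with
  | nil => rcases v with _ | ⟨y, s⟩ <;> simp
  | cons z u ih =>
    rcases v with _ | ⟨z', v⟩
    · simp
    · by_cases hz : z = z'
      · subst hz
        rcases ih v with rfl | ⟨y, s, rfl⟩ | ⟨y, s, rfl⟩ | ⟨p, y, s, y', s', rfl, rfl, hy⟩
        · simp
        · exact Or.inr (Or.inl ⟨y, s, rfl⟩)
        · exact Or.inr (Or.inr (Or.inl ⟨y, s, rfl⟩))
        · exact Or.inr (Or.inr (Or.inr ⟨z :: p, y, s, y', s', rfl, rfl, hy⟩))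
      · exact Or.inr (Or.inr (Or.inr ⟨[], z, u, z', v, rfl, rfl, hz⟩))

/-! ### Reading block words in `B₂¹` -/

/-- Extends an assignment by letting `t k` lead from the end of the `k`-th block, in the state `e k`,
to the beginning of the next one, in the state `s (k + 1)`. -/
def withSeparators (ν : Letter → PartialMap) (s e : ℕ → Fin 2) : Letter → PartialMap
  | t k => edge (e k) (s (k + 1))
  | z => ν z

theorem withSeparators_of_ne {ν : Letter → PartialMap} {s e : ℕ → Fin 2} {y : Letter}
    (h : ∀ k, y ≠ t k) : withSeparators ν s e y = ν y := by
  cases y with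
  | t k => exact absurd rfl (h k)
  | _ => rfl

theorem run_withSeparators {ν : Letter → PartialMap} {s e : ℕ → Fin 2} {B : List Letter}
    (h : ∀ k, t k ∉ B) : run (withSeparators ν s e) B = run ν B :=
  run_congr fun _ hy => withSeparators_of_ne fun k hk => h k (hk ▸ hy)

/-- If every block can be read under `ν`, then the separators `t k` can be chosen so that the whole
block word can be read, and the state `s` in which the `k`-th block is entered can be prescribed. -/
theorem exists_separators {ν : Letter → PartialMap} {b : ℕ → List Letter}
    (hb : ∀ k, IsBlock (b k)) (hν : ∀ y, toMatrix (ν y) ∈ BrandtMonoid)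
    (hr : ∀ j, ∃ s e, run ν (b j) s = some e) {k : ℕ} {s e : Fin 2}
    (hs : run ν (b k) s = some e) : ∃ (α : Letter → PartialMap) (σ : ℕ → Fin 2),
      (∀ z, toMatrix (α z) ∈ BrandtMonoid) ∧ (∀ z, (∀ j, z ≠ t j) → α z = ν z) ∧ σ k = s ∧
      (∀ q r, α (t k) q = some r → q = e) ∧
      ∀ j, run α (b j ++ [t j]) (σ j) = some (σ (j + 1)) := by
  choose s' e' hse using hr
  let σ := Function.update s' k s
  let τ := Function.update e' k e
  have hστ : ∀ j, run ν (b j) (σ j) = some (τ j) := by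
    intro j
    by_cases hj : j = k
    · subst hj; simpa [σ, τ] using hs
    · simpa [σ, τ, hj] using hse j
  refine ⟨withSeparators ν σ τ, σ, ?_, fun y hy => withSeparators_of_ne hy, by simp [σ], ?_, ?_⟩
  · intro y
    cases y with
    | t k => exact toMatrix_edge_mem_brandtMonoid _ _
    | _ => exact hν _
  · intro q r hq
    have := (edge_eq_some.1 hq).1
    simpa [τ] using this
  · intro j
    rw [run_append, run_withSeparators (hb j).t_notMem, hστ]
    simp [withSeparators, edge_self]

section Mismatch

variable {b : ℕ → List Letter} {m k : ℕ} {B Q w : List Letter} {y : Letter}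

theorem run_ne_none_of_sameValue (hb : ∀ k, IsBlock (b k))
    (h : SameValue BrandtMonoid (blockWord b m) w) (hB : B <+: b k)
    (hw : w = blockWord b k ++ B ++ y :: Q) {ν : Letter → PartialMap}
    (hν : ∀ y, toMatrix (ν y) ∈ BrandtMonoid) (hr : ∀ j, ∃ s e, run ν (b j) s = some e)
    (hy : ∀ j, y ≠ t j) {s e : Fin 2} (hs : run ν (b k) s = some e) :
    run ν (B ++ [y]) s ≠ none := by
  obtain ⟨α, σ, h₁, h₂, h₃, -, h₅⟩ := exists_separators hb hν hr hs
  have h₆ := h.run_prefix_ne_none (k := k) (B := B ++ [y]) (Q := Q) (by simp [hw]) h₁ h₅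
  rw [h₃] at h₆
  rwa [run_congr (β := ν)] at h₆
  intro z hz
  refine h₂ z fun j hj => ?_
  subst hj
  rcases List.mem_append.1 hz with hz | hz
  · exact (hb k).t_notMem j (hB.subset hz)
  · exact hy j (List.mem_singleton.1 hz).symm

theorem run_eq_of_sameValue (hb : ∀ k, IsBlock (b k))
    (h : SameValue BrandtMonoid (blockWord b m) w) (hB : B <+: b k)
    (hw : w = blockWord b k ++ B ++ t k :: Q) {ν : Letter → PartialMap}
    (hν : ∀ y, toMatrix (ν y) ∈ BrandtMonoid) (hr : ∀ j, ∃ s e, run ν (b j) s = some e)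
    {s e : Fin 2} (hs : run ν (b k) s = some e) : run ν B s = some e := by
  obtain ⟨α, σ, h₁, h₂, h₃, h₄, h₅⟩ := exists_separators hb hν hr hs
  have h₆ := h.run_prefix_ne_none (k := k) (B := B ++ [t k]) (Q := Q) (by simp [hw]) h₁ h₅
  have h₇ : run α B = run ν B :=
    run_congr fun z hz => h₂ z fun j hj => (hb k).t_notMem j (hB.subset (hj ▸ hz))
  rw [h₃, run_append, h₇] at h₆
  rcases hq : run ν B s with _ | q
  · simp [hq] at h₆
  · rcases hr' : α (t k) q with _ | r
    · simp [hq, hr'] at h₆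
    · rw [h₄ q r hr']

/-- The assignment under which `x p` is the arrow `0 → 1`, `x q` is the arrow `1 → 0` if `q ≠ p`, and
all other letters act as the identity. -/
def arrows (p q : ℕ) : Letter → PartialMap
  | x i => if i = p then edge 0 1 else if i = q then edge 1 0 else some
  | _ => some

@[simp] theorem arrows_a (p q : ℕ) : arrows p q a = some := rfl

@[simp] theorem arrows_x (p q i : ℕ) :
    arrows p q (x i) = if i = p then edge 0 1 else if i = q then edge 1 0 else some := rfl

theorem arrows_mem (p q : ℕ) (y : Letter) : toMatrix (arrows p q y) ∈ BrandtMonoid := by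
  have h1 : toMatrix some ∈ BrandtMonoid := by rw [toMatrix_some]; exact one_mem _
  cases y with
  | x i =>
    rw [arrows_x]
    split_ifs
    · exact toMatrix_edge_mem_brandtMonoid _ _
    · exact toMatrix_edge_mem_brandtMonoid _ _
    · exact h1
  | _ => exact h1

theorem IsBlock.exists_run_arrows {B : List Letter} (h : IsBlock B) (p q : ℕ) :
    ∃ s e, run (arrows p q) B s = some e := by
  cases h with
  | nil => exact ⟨0, 0, rfl⟩
  | single => exact ⟨0, 0, rfl⟩
  | @pair i j hij =>
    by_cases hi : i = p <;> by_cases hi' : i = q <;> by_cases hj : j = p <;>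
      by_cases hj' : j = q <;> by_cases hpq : q = p <;>
      simp [Fin.exists_fin_two, edge, hi, hi', hj, hj', hpq] <;> grind

theorem run_eq_some {α : Letter → PartialMap} {w : List Letter} (h : ∀ y ∈ w, α y = some) :
    run α w = some := by
  induction w with
  | nil => rfl
  | cons z w ih =>
    funext q
    rw [run_cons, h z (by simp), ih fun y hy => h y (by simp [hy])]
    rfl

/-- The letters `y` that the assignments `arrows p q` do not exclude as the successor of `B₁` in
place of the first letter of `B₂ · t k`, for a block `B₁ B₂`. -/
inductive Unresolved (k : ℕ) : List Letter → List Letter → Letter → Prop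
  | empty : Unresolved k [] [] a
  | repeated (B₁ B₂ : List Letter) : Unresolved k (B₁ ++ [a]) B₂ a
  | inner {i j : ℕ} (h : i ≠ j) : Unresolved k [a, x i] [x j, a] a
  | first {i j p : ℕ} (h : i ≠ j) (hp : p = i ∨ p = j) : Unresolved k [] [a, x i, x j, a] (x p)
  | single : Unresolved k [] [a] (t k)
  | last {i j : ℕ} (h : i ≠ j) : Unresolved k [a, x i, x j] [a] (t k)

/-- The letters `t k` come in the same order in a word with the same value as a block word. -/
theorem separator_eq (hb : ∀ k, IsBlock (b k)) (h : SameValue BrandtMonoid (blockWord b m) w)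
    (hB : B <+: b k) {j : ℕ} (hw : w = blockWord b k ++ B ++ t j :: Q) : j = k := by
  by_contra hj
  by_cases hjk : j < k
  · -- the arrow `t j` has been used before
    let α : Letter → PartialMap := fun y => if y = t j then edge 0 1 else some
    let σ : ℕ → Fin 2 := fun l => if l ≤ j then 0 else 1
    have hα : ∀ y, toMatrix (α y) ∈ BrandtMonoid := by
      intro y
      simp only [α]
      split_ifs
      · exact toMatrix_edge_mem_brandtMonoid _ _
      · rw [toMatrix_some]; exact one_mem _
    have hid : ∀ B : List Letter, t j ∉ B → run α B = some := fun B hB =>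
      run_eq_some fun y hy => if_neg (by rintro rfl; exact hB hy)
    have hσ : ∀ l, run α (b l ++ [t l]) (σ l) = some (σ (l + 1)) := by
      intro l
      rw [run_append, hid _ ((hb l).t_notMem j)]
      by_cases hl : l = j
      · subst hl; simp [α, σ, edge]
      · have : (l + 1 ≤ j) ↔ (l ≤ j) := by omega
        simp [α, σ, hl, this]
    have h₆ := h.run_prefix_ne_none (k := k) (B := B ++ [t j]) (Q := Q) (by simp [hw]) hα hσ
    rw [run_append, hid _ fun h' => (hb k).t_notMem j (hB.subset h')] at h₆
    simp [α, σ, hjk, edge] at h₆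
  · -- the arrow `t j` can be used only after the arrow `t k`
    let α : Letter → PartialMap :=
      fun y => if y = t k then edge 0 1 else if y = t j then edge 1 0 else some
    let σ : ℕ → Fin 2 := fun l => if l ≤ k then 0 else if l ≤ j then 1 else 0
    have hα : ∀ y, toMatrix (α y) ∈ BrandtMonoid := by
      intro y
      simp only [α]
      split_ifs
      · exact toMatrix_edge_mem_brandtMonoid _ _
      · exact toMatrix_edge_mem_brandtMonoid _ _
      · rw [toMatrix_some]; exact one_mem _
    have hid : ∀ B : List Letter, (∀ l, t l ∉ B) → run α B = some := by
      intro B hB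
      refine run_eq_some fun y hy => ?_
      simp only [α]
      rw [if_neg (by rintro rfl; exact hB _ hy), if_neg (by rintro rfl; exact hB _ hy)]
    have hσ : ∀ l, run α (b l ++ [t l]) (σ l) = some (σ (l + 1)) := by
      intro l
      rw [run_append, hid _ (hb l).t_notMem]
      by_cases hl : l = k
      · subst hl
        have : l + 1 ≤ j := by omega
        simp [α, σ, edge, this]
      · by_cases hl' : l = j
        · subst hl'
          have : ¬ l ≤ k := by omega
          have h' : ¬ l + 1 ≤ k := by omega
          simp [α, σ, hl, this, h', edge]
        · have h₁ : (l + 1 ≤ j) ↔ (l ≤ j) := by omega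
          have h₂ : (l + 1 ≤ k) ↔ (l ≤ k) := by omega
          simp [α, σ, hl, hl', h₁, h₂]
    have h₆ := h.run_prefix_ne_none (k := k) (B := B ++ [t j]) (Q := Q) (by simp [hw]) hα hσ
    rw [run_append, hid _ fun l h' => (hb k).t_notMem l (hB.subset h')] at h₆
    simp [α, σ, hj, edge] at h₆

theorem append_eq_single {β : Type*} {c : β} {B₁ B₂ : List β} (h : B₁ ++ B₂ = [c]) :
    B₁ = [] ∧ B₂ = [c] ∨ B₁ = [c] ∧ B₂ = [] := by
  rcases B₁ with _ | ⟨_, B₁⟩ <;> simp_all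

theorem append_eq_four {β : Type*} {c d e f : β} {B₁ B₂ : List β} (h : B₁ ++ B₂ = [c, d, e, f]) :
    B₁ = [] ∧ B₂ = [c, d, e, f] ∨ B₁ = [c] ∧ B₂ = [d, e, f] ∨ B₁ = [c, d] ∧ B₂ = [e, f] ∨
      B₁ = [c, d, e] ∧ B₂ = [f] ∨ B₁ = [c, d, e, f] ∧ B₂ = [] := by
  rcases B₁ with _ | ⟨_, _ | ⟨_, _ | ⟨_, _ | ⟨_, B₁⟩⟩⟩⟩ <;> simp_all

/-- The assignments `arrows p q` exclude all first differences but the unresolved ones. If a wrong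
letter `x p` comes after its occurrence in the block, or does not occur in the block, then it is read
in the state `1`, and if it replaces `x q`, then this is achieved by the arrow `1 → 0` of `x q`. If
`t k` comes before an occurrence of `x p` in the block, then it is read in the state `0`. -/
theorem unresolved_of_mismatch (hb : ∀ k, IsBlock (b k))
    (h : SameValue BrandtMonoid (blockWord b m) w) {B₁ B₂ R : List Letter} {z : Letter}
    (hB : b k = B₁ ++ B₂) (hw : w = blockWord b k ++ B₁ ++ y :: Q) (hz : z :: R = B₂ ++ [t k])
    (hzy : z ≠ y) : Unresolved k B₁ B₂ y := by
  have hpre : B₁ <+: b k := ⟨B₂, hB.symm⟩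
  have hbk := hb k
  have hr := fun p q j => (hb j).exists_run_arrows p q
  rw [hB] at hbk
  cases y with
  | t j =>
    obtain rfl := separator_eq hb h hpre hw
    have key := fun p s e => run_eq_of_sameValue (s := s) (e := e) hb h hpre hw (arrows_mem p p)
      (hr p p)
    rw [hB] at key
    clear hw hpre hr hb h hB
    generalize hC : B₁ ++ B₂ = C at hbk key
    cases hbk with
    | nil => simp_all
    | single =>
      rcases append_eq_single hC with ⟨rfl, rfl⟩ | ⟨rfl, rfl⟩
      · exact .single
      · simp_all
    | @pair i l hil =>
      rcases append_eq_four hC with ⟨rfl, rfl⟩ | ⟨rfl, rfl⟩ | ⟨rfl, rfl⟩ | ⟨rfl, rfl⟩ | ⟨rfl, rfl⟩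
      · have := key i 0 1
        simp [hil.symm, edge] at this
      · have := key i 0 1
        simp [hil.symm, edge] at this
      · have := key l 0 1
        simp [hil, edge] at this
      · exact .last hil
      · simp_all
  | x p =>
    have key := fun q s e => run_ne_none_of_sameValue (s := s) (e := e) hb h hpre hw
      (arrows_mem p q) (hr p q) (by simp)
    rw [hB] at key
    clear hw hpre hr hb h hB
    generalize hC : B₁ ++ B₂ = C at hbk key
    cases hbk with
    | nil =>
      have := key p 1 1
      simp_all [edge]
    | single =>
      have := key p 1 1
      rcases append_eq_single hC with ⟨rfl, rfl⟩ | ⟨rfl, rfl⟩ <;> simp [edge] at this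
    | @pair i l hil =>
      by_cases hp : p = i ∨ p = l
      · rcases append_eq_four hC with ⟨rfl, rfl⟩ | ⟨rfl, rfl⟩ | ⟨rfl, rfl⟩ | ⟨rfl, rfl⟩ | ⟨rfl, rfl⟩
        · exact .first hil hp
        · rcases hp with rfl | rfl
          · simp_all
          · have := key i 1 1
            simp [hil, edge] at this
        · rcases hp with rfl | rfl
          · have := key p 0 1
            simp [hil.symm, edge] at this
          · simp_all
        · have := key p 0 1
          rcases hp with rfl | rfl <;> simp [hil, hil.symm, edge] at this
        · have := key p 0 1
          rcases hp with rfl | rfl <;> simp [hil, hil.symm, edge] at this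
      · rw [not_or] at hp
        have := key p 1 1
        rcases append_eq_four hC with ⟨rfl, rfl⟩ | ⟨rfl, rfl⟩ | ⟨rfl, rfl⟩ | ⟨rfl, rfl⟩ | ⟨rfl, rfl⟩ <;>
        simp [Ne.symm hp.1, Ne.symm hp.2, edge] at this
  | a =>
    clear hw hpre hr hb h hB
    generalize hC : B₁ ++ B₂ = C at hbk
    cases hbk with
    | nil =>
      rw [List.append_eq_nil_iff] at hC
      obtain ⟨rfl, rfl⟩ := hC
      exact .empty
    | single =>
      rcases append_eq_single hC with ⟨rfl, rfl⟩ | ⟨rfl, rfl⟩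
      · simp_all
      · exact .repeated [] _
    | @pair i l hil =>
      rcases append_eq_four hC with ⟨rfl, rfl⟩ | ⟨rfl, rfl⟩ | ⟨rfl, rfl⟩ | ⟨rfl, rfl⟩ | ⟨rfl, rfl⟩
      · simp_all
      · exact .repeated [] _
      · exact .inner hil
      · simp_all
      · exact .repeated [a, x i, x l] _

theorem run_eq_none_of_mem {y : Letter} {w : List Letter} (hy : y ∈ w) :
    run (fun z => if z = y then edge 0 1 else some) w 1 = none := by
  induction w with
  | nil => simp at hy
  | cons z w ih =>
    by_cases hz : z = y
    · simp [hz, edge]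
    · have : y ∈ w := by simpa [Ne.symm hz] using hy
      simp [hz, ih this]

/-- A word with the same value as a block word is equal to it, unless some first difference is
left unresolved. The block `b m` is appended to detect a word that has the block word as a proper
prefix, or conversely. -/
theorem eq_blockWord_of_sameValue (hb : ∀ k, IsBlock (b k))
    (h : SameValue BrandtMonoid (blockWord b m) w)
    (H : ∀ k B₁ B₂ y Q, b k = B₁ ++ B₂ →
      w ++ (b m ++ [t m]) = blockWord b k ++ B₁ ++ y :: Q → ¬ Unresolved k B₁ B₂ y) :
    w = blockWord b m := by
  have h' : SameValue BrandtMonoid (blockWord b (m + 1)) (w ++ (b m ++ [t m])) :=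
    h.append_right _
  suffices hs : blockWord b (m + 1) = w ++ (b m ++ [t m]) from (List.append_cancel_right hs).symm
  have hnot : t m ∉ blockWord b m ++ b m := by
    simp [t_mem_blockWord hb, (hb m).t_notMem]
  rcases List.eq_or_exists_mismatch (blockWord b (m + 1)) (w ++ (b m ++ [t m])) with
    heq | ⟨y, s, heq⟩ | ⟨y, s, heq⟩ | ⟨p, y, s, y', s', h₁, h₂, hy⟩
  · exact heq
  · exfalso
    have hmem : t m ∈ y :: s := by
      rcases List.eq_nil_or_concat (y :: s) with hs | ⟨s', z, hs⟩
      · simp at hs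
      · rw [hs, List.concat_eq_append, ← List.append_assoc, ← List.append_assoc] at heq
        have hz := (List.append_inj' heq rfl).2
        simp only [List.cons.injEq, and_true] at hz
        simp [hs, hz]
    refine h'.run_prefix_ne_none (k := m + 1) (B := y :: s) (Q := []) (by simp [heq])
      (α := fun z => if z = t m then edge 0 1 else some)
      (σ := fun l => if l ≤ m then 0 else 1) ?_ ?_ ?_
    · intro z
      split_ifs
      · exact toMatrix_edge_mem_brandtMonoid _ _
      · rw [toMatrix_some]; exact one_mem _
    · intro l
      rw [run_append, run_eq_some fun y hy => if_neg (by rintro rfl; exact (hb l).t_notMem m hy)]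
      by_cases hl : l = m
      · subst hl; simp [edge]
      · have : (l + 1 ≤ m) ↔ (l ≤ m) := by omega
        simp [hl, this]
    · -- the second occurrence of `t m` cannot be read
      simpa using run_eq_none_of_mem hmem
  · exfalso
    rw [blockWord, ← List.append_assoc] at heq
    have hd := congrArg List.dropLast heq
    rw [List.dropLast_concat, List.dropLast_append_of_ne_nil (by simp)] at hd
    apply hnot
    rw [hd]
    simp
  · obtain ⟨k, hk, B₁, B₂, R, hB, rfl, hyR⟩ := blockWord_eq_append h₁
    exfalso
    refine H k B₁ B₂ y' s' hB h₂ ?_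
    rcases B₂ with _ | ⟨c, B₂⟩
    · rw [List.nil_append, List.cons.injEq] at hyR
      exact unresolved_of_mismatch (R := []) hb h' hB h₂ (by simp [hyR.1]) hy
    · rw [List.cons_append, List.cons.injEq] at hyR
      exact unresolved_of_mismatch (R := B₂ ++ [t k]) hb h' hB h₂ (by simp [hyR.1]) hy

end Mismatch

/-! ### Block words determined by their values -/

theorem SameValue.brandtMonoid {u v : List Letter} (h : SameValue ATwoOneMonoid u v) :
    SameValue BrandtMonoid u v := by
  intro φ
  have := lift_eq_brandtMonoid_of_aTwoOneMonoid (u := FreeMonoid.ofList u)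
    (v := FreeMonoid.ofList v) (fun θ => by simpa [FreeMonoid.lift_apply] using h θ) φ
  simpa [FreeMonoid.lift_apply] using this

/-- The assignment attached to a colour class: `a` is the arrow `0 → 1`, the letters `x i` with `i` of
colour `c` are the arrow `1 → 0`, and all other letters act as the identity. -/
def colouring (f : ℕ → Bool) (c : Bool) : Letter → PartialMap
  | a => edge 0 1
  | x i => if f i = c then edge 1 0 else some
  | t _ => some

theorem colouring_mem (f : ℕ → Bool) (c : Bool) (y : Letter) :
    toMatrix (colouring f c y) ∈ BrandtMonoid := by
  have h1 : toMatrix some ∈ BrandtMonoid := by rw [toMatrix_some]; exact one_mem _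
  cases y with
  | a => exact toMatrix_edge_mem_brandtMonoid _ _
  | x i =>
    simp only [colouring]
    split_ifs
    · exact toMatrix_edge_mem_brandtMonoid _ _
    · exact h1
  | t => exact h1

theorem run_colouring_pair {f : ℕ → Bool} {i j : ℕ} (h : f i ≠ f j) (c : Bool) :
    run (colouring f c) [a, x i, x j, a] 0 = some 1 := by
  by_cases hi : f i = c
  · have : f j ≠ c := fun hj => h (hi.trans hj.symm)
    simp [colouring, edge, hi, this]
  · have : f j = c := by
      revert h hi; cases f i <;> cases f j <;> cases c <;> simp
    simp [colouring, edge, hi, this]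

/-- If a two-colouring separates `i` from `j` for every block `a xᵢ xⱼ a`, then the block word is
determined by its values in `B₂¹`. -/
theorem eq_blockWord_of_colouring {b : ℕ → List Letter} {m : ℕ} {w : List Letter}
    (hb : ∀ k, IsBlock (b k)) {f : ℕ → Bool}
    (hf : ∀ k i j, b k = [a, x i, x j, a] → f i ≠ f j)
    (h : SameValue BrandtMonoid (blockWord b m) w) : w = blockWord b m := by
  have hr : ∀ c j, ∃ s e, run (colouring f c) (b j) s = some e := by
    intro c j
    have hbj := hb j
    generalize hB : b j = B at hbj
    cases hbj with
    | nil => exact ⟨0, 0, rfl⟩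
    | single => exact ⟨0, 1, rfl⟩
    | pair => exact ⟨0, 1, run_colouring_pair (hf j _ _ hB) c⟩
  refine eq_blockWord_of_sameValue hb h fun k B₁ B₂ y Q hB hw hun => ?_
  have h' : SameValue BrandtMonoid (blockWord b (m + 1)) (w ++ (b m ++ [t m])) :=
    h.append_right _
  have hpre : B₁ <+: b k := ⟨B₂, hB.symm⟩
  have key := fun c s e hy => run_ne_none_of_sameValue (s := s) (e := e) hb h' hpre hw
    (colouring_mem f c) (hr c) hy
  -- `a` is stuck in `1`, the letters `x l` of colour `c` in `0`, and each nonempty block leads from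
  -- `0` to `1`
  cases hun with
  | empty => exact key true 1 1 (by simp) (by simp [hB]) rfl
  | repeated B₁ _ =>
    obtain ⟨s, e, hs⟩ := hr true k
    refine key true s e (by simp) hs ?_
    rw [List.append_assoc, run_append]
    rcases run (colouring f true) B₁ s with _ | q
    · rfl
    · fin_cases q <;> rfl
  | @inner i j hij =>
    have hc := hf k i j hB
    refine key (f j) 0 1 (by simp) (by rw [hB]; exact run_colouring_pair hc _) ?_
    simp [colouring, edge, hc]
  | @first i j p hij hp =>
    have hc := hf k i j hB
    refine key (f p) 0 1 (by simp) (by rw [hB]; exact run_colouring_pair hc _) ?_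
    simp [colouring, edge]
  | single =>
    have := run_eq_of_sameValue (s := 0) (e := 1) hb h' hpre hw (colouring_mem f true) (hr true)
      (by rw [hB]; rfl)
    simp at this
  | @last i j hij =>
    have hc := run_colouring_pair (hf k i j hB) true
    have := run_eq_of_sameValue (s := 0) (e := 1) hb h' hpre hw (colouring_mem f true) (hr true)
      (by rw [hB]; exact hc)
    rw [show [a, x i, x j, a] = [a, x i, x j] ++ [a] from rfl, run_append, this] at hc
    simp [colouring, edge] at hc

/-- The assignment with the given values on `a`, on the letters `x i`, and on the letters `t k`. -/
def assign (fa : PartialMap) (fx ft : ℕ → PartialMap) : Letter → PartialMap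
  | a => fa
  | x i => fx i
  | t k => ft k

theorem assign_mem {S : Submonoid (Matrix (Fin 2) (Fin 2) ℤ)} {fa : PartialMap}
    {fx ft : ℕ → PartialMap} (ha : toMatrix fa ∈ S) (hx : ∀ i, toMatrix (fx i) ∈ S)
    (ht : ∀ k, toMatrix (ft k) ∈ S) (y : Letter) : toMatrix (assign fa fx ft y) ∈ S := by
  cases y with
  | a => exact ha
  | x i => exact hx i
  | t k => exact ht k

/-- A block word without empty blocks is determined by its values in `A₂¹`. -/
theorem eq_blockWord_of_aTwoOneMonoid {b : ℕ → List Letter} {m : ℕ} {w : List Letter}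
    (hb : ∀ k, IsBlock (b k)) (hne : ∀ k, b k ≠ [])
    (h : SameValue ATwoOneMonoid (blockWord b m) w) : w = blockWord b m := by
  have hb' : ∀ j, b j = [a] ∨ ∃ p q, p ≠ q ∧ b j = [a, x p, x q, a] := by
    intro j
    have hbj := hb j
    have hnej := hne j
    generalize b j = B at hbj hnej
    cases hbj with
    | nil => exact absurd rfl hnej
    | single => exact Or.inl rfl
    | pair hpq => exact Or.inr ⟨_, _, hpq, rfl⟩
  refine eq_blockWord_of_sameValue hb h.brandtMonoid fun k B₁ B₂ y Q hB hw hun => ?_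
  have h' : SameValue ATwoOneMonoid (blockWord b (m + 1)) (w ++ (b m ++ [t m])) :=
    h.append_right _
  have key := fun α σ hα hσ => h'.run_prefix_ne_none (k := k) (B := B₁ ++ [y]) (Q := Q)
    (by simp [hw]) (α := α) hα (σ := σ) hσ
  clear hw h h'
  have hone : toMatrix some ∈ ATwoOneMonoid := by rw [toMatrix_some]; exact one_mem _
  have hedge := toMatrix_edge_mem_aTwoOneMonoid
  have hreset := toMatrix_reset_mem_aTwoOneMonoid
  -- `t k` can be read only in the state `0`, to which `a` resets; all other letters reset to `1`
  have hsep : y = t k → run (assign (reset 0) (fun _ => reset 1)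
      fun j => if j = k then edge 0 0 else reset 1) (B₁ ++ [t k]) 1 ≠ none := by
    rintro rfl
    have := key (assign (reset 0) (fun _ => reset 1) fun j => if j = k then edge 0 0 else reset 1)
      (fun j => if j = k + 1 then 0 else 1)
      (assign_mem (hreset _) (fun _ => hreset _) fun j => by
        split_ifs
        · exact hedge _
        · exact hreset _) ?_
    · simpa using this
    · intro j
      rcases hb' j with hj | ⟨p, q, hpq, hj⟩ <;> rw [hj] <;> by_cases hjk : j = k <;>
        simp [edge, reset, assign, hjk]
  cases hun with
  | empty => exact hne k hB
  | repeated B₁ _ =>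
    -- `a` can be read only in the state `0` and leads to `1`, so there is no factor `a a`
    refine key (assign (edge 0 1) (fun _ => reset 0) fun _ => reset 0) (fun _ => 0)
      (assign_mem (hedge _) (fun _ => hreset _) fun _ => hreset _) ?_ ?_
    · intro j
      rcases hb' j with hj | ⟨p, q, hpq, hj⟩ <;> rw [hj] <;> simp [edge, reset, assign]
    · rw [List.append_assoc, run_append]
      rcases run _ B₁ 0 with _ | q
      · rfl
      · fin_cases q <;> rfl
  | @inner i j hij =>
    -- moreover `x i` acts as the identity, so there is no factor `a xᵢ a`
    refine key (assign (edge 0 1) (fun l => if l = i then some else reset 0) fun _ => reset 0)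
      (fun _ => 0) (assign_mem (hedge _) (fun l => ?_) fun _ => hreset _) ?_ ?_
    · split_ifs
      · exact hone
      · exact hreset _
    · intro l
      rcases hb' l with hl | ⟨p, q, hpq, hl⟩ <;> rw [hl]
      · simp [edge, reset, assign]
      · by_cases hp : p = i
        · have : q ≠ i := fun hq => hpq (hp.trans hq.symm)
          simp [edge, reset, assign, hp, this]
        · by_cases hq : q = i <;> simp [edge, reset, assign, hp, hq]
    · simp [edge, assign]
  | @first i j p hij hp =>
    -- the letters `x l` can be read only in the state `0`, so they do not follow a separator
    refine key (assign (reset 0) (fun _ => edge 0 0) fun _ => reset 1) (fun _ => 1)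
      (assign_mem (hreset _) (fun _ => hedge _) fun _ => hreset _) ?_ ?_
    · intro j
      rcases hb' j with hj | ⟨p, q, hpq, hj⟩ <;> rw [hj] <;> simp [edge, reset, assign]
    · simp [edge, assign]
  | single => simp [edge, assign] at hsep
  | @last i j hij => simp [edge, reset, assign] at hsep

/-! ### The words of a cycle -/

/-- The blocks attached to the cycle of length `n`: both `a xᵢ xⱼ a` and `a xⱼ xᵢ a` for every edge
`{i, j}`, and then `a`. The edge between `i` and its successor has the blocks with the indices `2 i`
and `2 i + 1`. -/
def cycleBlock (n k : ℕ) : List Letter :=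
  if k < 2 * n then
    if k % 2 = 0 then [a, x (k / 2), x ((k / 2 + 1) % n), a]
    else [a, x ((k / 2 + 1) % n), x (k / 2), a]
  else [a]

/-- The left-hand side of the identity of the cycle of length `n`. -/
def cycleWord (n : ℕ) : List Letter := blockWord (cycleBlock n) (2 * n + 1)

/-- The right-hand side of the identity of the cycle of length `n`: the last block `a` of the
left-hand side becomes `a a`. -/
def cycleWordSq (n : ℕ) : List Letter := blockWord (cycleBlock n) (2 * n) ++ [a, a, t (2 * n)]

theorem cycleWord_eq (n : ℕ) :
    cycleWord n = blockWord (cycleBlock n) (2 * n) ++ [a, t (2 * n)] := by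
  simp [cycleWord, blockWord, cycleBlock]

theorem succ_mod_ne {n i : ℕ} (hn : 2 ≤ n) (hi : i < n) : i ≠ (i + 1) % n := by
  rcases Nat.lt_or_ge (i + 1) n with h | h
  · rw [Nat.mod_eq_of_lt h]; omega
  · have : i + 1 = n := by omega
    rw [this, Nat.mod_self]; omega

theorem isBlock_cycleBlock {n : ℕ} (hn : 2 ≤ n) (k : ℕ) : IsBlock (cycleBlock n k) := by
  unfold cycleBlock
  split_ifs with h₁ h₂
  · exact .pair (succ_mod_ne hn (by omega))
  · exact .pair (succ_mod_ne hn (by omega)).symm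
  · exact .single

theorem cycleBlock_ne_nil (n k : ℕ) : cycleBlock n k ≠ [] := by
  unfold cycleBlock
  split_ifs <;> simp

theorem length_blockWord_cycleBlock {n m : ℕ} (hm : m ≤ 2 * n) :
    (blockWord (cycleBlock n) m).length = 5 * m := by
  induction m with
  | zero => rfl
  | succ m ih =>
    have h : (cycleBlock n m).length = 4 := by
      unfold cycleBlock
      split_ifs
      · rfl
      · rfl
      · omega
    simp only [blockWord, List.length_append, ih (by omega), h, List.length_singleton]
    omega

theorem length_cycleWord (n : ℕ) : (cycleWord n).length = 10 * n + 2 := by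
  rw [cycleWord_eq, List.length_append, length_blockWord_cycleBlock le_rfl]
  simp
  omega

theorem length_cycleWordSq (n : ℕ) : (cycleWordSq n).length = 10 * n + 3 := by
  rw [cycleWordSq, List.length_append, length_blockWord_cycleBlock le_rfl]
  simp
  omega

theorem le_length_flatMap_blockWord_cycleBlock {n m : ℕ} {θ : Letter → List Letter} (hθ : θ a ≠ [])
    (hm : m ≤ 2 * n) : 2 * m ≤ ((blockWord (cycleBlock n) m).flatMap θ).length := by
  have ha : 1 ≤ (θ a).length := List.length_pos_iff.2 hθ
  induction m with
  | zero => simp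
  | succ m ih =>
    have h : 2 ≤ ((cycleBlock n m).flatMap θ).length := by
      unfold cycleBlock
      split_ifs
      · simp; omega
      · simp; omega
      · omega
    have := ih (by omega)
    simp only [blockWord, List.flatMap_append, List.length_append]
    omega

/-! ### The identities of odd cycles hold in `B₂¹` -/

/-- The zero of `B₂¹`. -/
def BrandtMonoid.zero : BrandtMonoid := ⟨!![0, 0; 0, 0], by simp [BrandtMonoid]⟩

theorem BrandtMonoid.zero_mul (y : BrandtMonoid) : zero * y = zero := by
  apply Subtype.ext
  have : (!![0, 0; 0, 0] : Matrix (Fin 2) (Fin 2) ℤ) = 0 := by decide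
  simp [zero, this]

theorem BrandtMonoid.mul_zero (y : BrandtMonoid) : y * zero = zero := by
  apply Subtype.ext
  have : (!![0, 0; 0, 0] : Matrix (Fin 2) (Fin 2) ℤ) = 0 := by decide
  simp [zero, this]

theorem BrandtMonoid.block_ne_zero {b : ℕ → List Letter} {φ : Letter → BrandtMonoid} {m : ℕ}
    (h : ((blockWord b m).map φ).prod ≠ zero) {k : ℕ} (hk : k < m) :
    ((b k).map φ).prod ≠ zero := by
  induction m with
  | zero => omega
  | succ m ih =>
    simp only [blockWord, List.map_append, List.prod_append] at h
    rcases Nat.lt_succ_iff_lt_or_eq.1 hk with hk | rfl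
    · exact ih (fun h' => h (by rw [h', zero_mul])) hk
    · exact fun h' => h (by rw [h', zero_mul, mul_zero])

/-- The vertices of an odd cycle cannot be labelled in such a way that exactly one end of each edge
is labelled. -/
theorem not_alternating_of_odd {n : ℕ} (hn : Odd n) {p : ℕ → Prop}
    (h : ∀ i < n, (p i ↔ ¬ p ((i + 1) % n))) : False := by
  have hpos : 0 < n := hn.pos
  have key : ∀ i < n, (p i ↔ (p 0 ↔ Even i)) := by
    intro i
    induction i with
    | zero => simp
    | succ i ih =>
      intro hi
      have h₁ := ih (by omega)
      have h₂ := h i (by omega)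
      rw [Nat.mod_eq_of_lt hi] at h₂
      rw [Nat.even_add_one]
      tauto
  have h₁ := key (n - 1) (by omega)
  have h₂ := h (n - 1) (by omega)
  rw [Nat.sub_add_cancel hpos, Nat.mod_self] at h₂
  have : Even (n - 1) := Nat.Odd.sub_odd hn odd_one
  tauto

theorem sameValue_cycleWord {n : ℕ} (hn : Odd n) :
    SameValue BrandtMonoid (cycleWord n) (cycleWordSq n) := by
  intro φ
  rw [cycleWord_eq, cycleWordSq]
  simp only [List.map_append, List.prod_append, List.map_cons, List.prod_cons, List.map_nil,
    List.prod_nil, mul_one]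
  by_cases ha : φ a * φ a = φ a
  · rw [← mul_assoc (φ a) (φ a), ha]
  by_cases hz : ((blockWord (cycleBlock n) (2 * n)).map φ).prod = BrandtMonoid.zero
  · rw [hz, BrandtMonoid.zero_mul, BrandtMonoid.zero_mul]
  exfalso
  refine not_alternating_of_odd hn (p := fun i => φ (x i) = 1) fun i hi => ?_
  have h₁ := BrandtMonoid.block_ne_zero hz (k := 2 * i) (by omega)
  have h₂ := BrandtMonoid.block_ne_zero hz (k := 2 * i + 1) (by omega)
  have e₁ : (2 * i + 1) / 2 = i := by omega
  have e₂ : (2 * i + 1) % 2 = 1 := by omega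
  have e₃ : 2 * i + 1 < 2 * n := by omega
  simp only [cycleBlock, hi, e₁, e₂, e₃, Nat.mul_mod_right, if_true, Nat.mul_div_cancel_left,
    Nat.zero_lt_two, one_ne_zero, if_false, mul_lt_mul_iff_right₀, List.map_cons, List.map_nil,
    List.prod_cons, List.prod_nil, mul_one, ← mul_assoc] at h₁ h₂
  exact BrandtMonoid.eq_one_iff_ne_one ha h₁ h₂

/-- The letters as variables. -/
def Letter.code : Letter → ℕ
  | a => 0
  | x i => 2 * i + 1
  | t k => 2 * k + 2

theorem Letter.code_injective : Function.Injective Letter.code := by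
  rintro (_ | i | k) (_ | j | l) h <;> simp [Letter.code] at h ⊢ <;> omega

/-- The identity of the cycle of length `n`. -/
def cycleIdentity (n : ℕ) : MonoidIdentity :=
  (FreeMonoid.ofList ((cycleWord n).map code), FreeMonoid.ofList ((cycleWordSq n).map code))

theorem cycleIdentity_holdsIn {n : ℕ} (hn : Odd n) : (cycleIdentity n).HoldsIn BrandtMonoid := by
  intro θ
  simpa [cycleIdentity, FreeMonoid.lift_apply] using sameValue_cycleWord hn (θ ∘ code)

/-! ### Syntactic monoids -/

/-- The syntactic congruence of the language with the single word `w`. -/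
def syntacticCon {β : Type} (w : FreeMonoid β) : Con (FreeMonoid β) where
  r u v := ∀ p q, p * u * q = w ↔ p * v * q = w
  iseqv := ⟨fun _ _ _ => Iff.rfl, fun h p q => (h p q).symm, fun h h' p q => (h p q).trans (h' p q)⟩
  mul' := by
    intro u v u' v' h h' p q
    have h₁ := h p (u' * q)
    have h₂ := h' (p * v) q
    simp only [mul_assoc] at h₁ h₂ ⊢
    exact h₁.trans h₂

theorem toList_lift {β γ : Type} (θ : β → FreeMonoid γ) (u : FreeMonoid β) :
    (FreeMonoid.lift θ u).toList = u.toList.flatMap fun i => (θ i).toList := by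
  induction u using FreeMonoid.inductionOn' with
  | one => rfl
  | of_mul i u ih => simp [ih]

/-- The syntactic monoid of `w` satisfies an identity as soon as `w` does not change when the
identity is applied to a factor of it. -/
theorem holdsIn_syntacticCon {w : List Letter} {P : MonoidIdentity}
    (h : ∀ (θ : ℕ → List Letter) (p q : List Letter),
      p ++ P.1.toList.flatMap θ ++ q = w ↔ p ++ P.2.toList.flatMap θ ++ q = w) :
    P.HoldsIn (syntacticCon (FreeMonoid.ofList w)).Quotient := by
  intro θ
  choose θ' hθ' using fun i => Con.mk'_surjective (c := syntacticCon (FreeMonoid.ofList w)) (θ i)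
  have key : ∀ u : FreeMonoid ℕ, FreeMonoid.lift θ u =
      (syntacticCon (FreeMonoid.ofList w)).mk' (FreeMonoid.lift θ' u) := by
    intro u
    rw [← MonoidHom.comp_apply, FreeMonoid.comp_lift]
    congr 2
    funext i
    exact (hθ' i).symm
  rw [key, key]
  refine (Con.eq _).2 fun p q => ?_
  have := h (fun i => (θ' i).toList) p.toList q.toList
  rw [← toList_lift, ← toList_lift] at this
  exact this

/-- Conversely, `w` does not change when an identity of its syntactic monoid is applied to it. -/
theorem eq_of_holdsIn_syntacticCon {u v : List Letter}
    (h : MonoidIdentity.HoldsIn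
      (FreeMonoid.ofList (u.map code), FreeMonoid.ofList (v.map code))
      (syntacticCon (FreeMonoid.ofList u)).Quotient) : v = u := by
  have : Nonempty Letter := ⟨a⟩
  have hinv : ∀ y, Function.invFun code (code y) = y :=
    Function.leftInverse_invFun code_injective
  have key : ∀ z : List Letter, FreeMonoid.lift (fun i =>
      (syntacticCon (FreeMonoid.ofList u)).mk' (FreeMonoid.of (Function.invFun code i)))
      (FreeMonoid.ofList (z.map code)) =
      (syntacticCon (FreeMonoid.ofList u)).mk' (FreeMonoid.ofList z) := by
    intro z
    induction z with
    | nil => rfl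
    | cons y z ih =>
      rw [List.map_cons, FreeMonoid.ofList_cons, map_mul, ih, FreeMonoid.lift_eval_of, hinv,
        ← map_mul, FreeMonoid.ofList_cons]
  have h' := h fun i =>
    (syntacticCon (FreeMonoid.ofList u)).mk' (FreeMonoid.of (Function.invFun code i))
  simp only [key] at h'
  have := ((Con.eq _).1 h' 1 1).1 (by simp)
  simpa using this

theorem prod_map_flatMap {M : Type} [Monoid M] (θ : ℕ → List Letter) (φ : Letter → M)
    (u : List ℕ) : ((u.flatMap θ).map φ).prod = (u.map fun i => ((θ i).map φ).prod).prod := by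
  induction u with
  | nil => rfl
  | cons i u ih => simp [ih]

theorem sameValue_of_holdsIn {S : Submonoid (Matrix (Fin 2) (Fin 2) ℤ)} {P : MonoidIdentity}
    (h : P.HoldsIn S) (θ : ℕ → List Letter) (p q : List Letter) :
    SameValue S (p ++ P.1.toList.flatMap θ ++ q) (p ++ P.2.toList.flatMap θ ++ q) := by
  intro φ
  have := h fun i => ((θ i).map φ).prod
  rw [FreeMonoid.lift_apply, FreeMonoid.lift_apply] at this
  simp only [List.map_append, List.prod_append, prod_map_flatMap, this]

/-- The syntactic monoid of the word of the cycle of length `n`. -/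
abbrev CycleMonoid (n : ℕ) : Type := (syntacticCon (FreeMonoid.ofList (cycleWord n))).Quotient

theorem cycleIdentity_not_holdsIn (n : ℕ) : ¬ (cycleIdentity n).HoldsIn (CycleMonoid n) := by
  intro h
  have := congrArg List.length (eq_of_holdsIn_syntacticCon h)
  rw [length_cycleWord, length_cycleWordSq] at this
  omega

theorem eq_cycleWord_of_sameValue {n : ℕ} (hn : 2 ≤ n) {w : List Letter}
    (h : SameValue ATwoOneMonoid (cycleWord n) w) : w = cycleWord n :=
  eq_blockWord_of_aTwoOneMonoid (isBlock_cycleBlock hn) (cycleBlock_ne_nil n) h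

theorem cycleMonoid_mem_varietyA {n : ℕ} (hn : 2 ≤ n) : varietyA.Mem (CycleMonoid n) := by
  refine MonoidVariety.mem_generatedBy_of_holdsIn fun P hP => holdsIn_syntacticCon fun θ p q => ?_
  have h := sameValue_of_holdsIn hP θ p q
  constructor
  · intro hw
    exact eq_cycleWord_of_sameValue hn (hw ▸ h)
  · intro hw
    exact eq_cycleWord_of_sameValue hn fun φ => by rw [← hw]; exact (h φ).symm

/-- The word of a cycle is square-free: since `A₂¹` satisfies `x² ≈ x³`, a square could be replaced
by a cube. -/
theorem eq_nil_of_square {n : ℕ} (hn : 2 ≤ n) {p q X : List Letter}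
    (h : p ++ (X ++ X) ++ q = cycleWord n) : X = [] := by
  have hs : SameValue ATwoOneMonoid (cycleWord n) (p ++ (X ++ X ++ X) ++ q) := by
    intro φ
    rw [← h]
    simp only [List.map_append, List.prod_append]
    rw [← ATwoOneMonoid.sq_eq_cube]
  have hl := congrArg List.length (eq_cycleWord_of_sameValue hn hs)
  rw [← h] at hl
  simp only [List.length_append] at hl
  exact List.eq_nil_of_length_eq_zero (by omega)

theorem squaresCommute_holdsIn_cycleMonoid {n : ℕ} (hn : 2 ≤ n) :
    squaresCommute.HoldsIn (CycleMonoid n) := by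
  refine holdsIn_syntacticCon fun θ p q => ?_
  have key : ∀ X Y : List Letter, p ++ (X ++ X ++ (Y ++ Y)) ++ q = cycleWord n →
      p ++ (Y ++ Y ++ (X ++ X)) ++ q = cycleWord n := by
    intro X Y h
    have hX : X = [] := eq_nil_of_square hn (p := p) (q := Y ++ Y ++ q) (by simpa using h)
    subst hX
    simpa using h
  have e : ∀ i j : ℕ, (FreeMonoid.of i ^ 2 * FreeMonoid.of j ^ 2).toList.flatMap θ =
      θ i ++ θ i ++ (θ j ++ θ j) := by
    intro i j
    simp [pow_two]
  simp only [squaresCommute, e]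
  exact ⟨key _ _, key _ _⟩

/-! ### Short identities of `B₂¹` -/

/-- The substitution that inserts the block `b k` before `t k` for all `k` in `s`. -/
def insertBlocks (b : ℕ → List Letter) (s : ℕ → Prop) [DecidablePred s] : Letter → List Letter
  | t k => if s k then b k ++ [t k] else [t k]
  | y => [y]

section InsertBlocks

variable {b : ℕ → List Letter} {s : ℕ → Prop} [DecidablePred s]

theorem insertBlocks_eq_concat (y : Letter) : ∃ B, insertBlocks b s y = B ++ [y] := by
  cases y with
  | t k =>
    by_cases hk : s k
    · exact ⟨b k, by simp [insertBlocks, hk]⟩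
    · exact ⟨[], by simp [insertBlocks, hk]⟩
  | _ => exact ⟨[], rfl⟩

/-- The substitution is injective, because the image of each letter ends with this letter. -/
theorem flatMap_insertBlocks_injective :
    Function.Injective fun w : List Letter => w.flatMap (insertBlocks b s) := by
  intro u v h
  induction u using List.reverseRecOn generalizing v with
  | nil =>
    rcases List.eq_nil_or_concat v with rfl | ⟨v, y, rfl⟩
    · rfl
    · obtain ⟨B, hB⟩ := insertBlocks_eq_concat (b := b) (s := s) y
      simp [hB] at h
  | append_singleton u z ih =>
    obtain ⟨C, hC⟩ := insertBlocks_eq_concat (b := b) (s := s) z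
    rcases List.eq_nil_or_concat v with rfl | ⟨v, y, rfl⟩
    · simp [hC] at h
    · obtain ⟨B, hB⟩ := insertBlocks_eq_concat (b := b) (s := s) y
      have hzy : z = y := by
        simp only [List.concat_eq_append, List.flatMap_append, List.flatMap_singleton, hB, hC,
          ← List.append_assoc] at h
        simpa using (List.append_inj' h rfl).2
      subst hzy
      simp only [List.concat_eq_append, List.flatMap_append, List.append_cancel_right_eq] at h ⊢
      rw [ih h]

theorem flatMap_insertBlocks_of_t_notMem {w : List Letter} (h : ∀ k, t k ∉ w) :
    w.flatMap (insertBlocks b s) = w := by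
  induction w with
  | nil => rfl
  | cons y w ih =>
    have hy : insertBlocks b s y = [y] := by
      cases y with
      | t k => exact absurd (List.mem_cons_self) (h k)
      | _ => rfl
    rw [List.flatMap_cons, hy, ih fun k hk => h k (List.mem_cons_of_mem _ hk)]
    rfl

theorem flatMap_insertBlocks_blockWord (hb : ∀ k, IsBlock (b k)) (m : ℕ) :
    (blockWord (fun k => if s k then [] else b k) m).flatMap (insertBlocks b s) =
      blockWord b m := by
  induction m with
  | zero => rfl
  | succ m ih =>
    simp only [blockWord, List.flatMap_append, ih, List.flatMap_singleton]
    by_cases hm : s m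
    · simp [hm, insertBlocks]
    · simp [hm, insertBlocks, flatMap_insertBlocks_of_t_notMem (hb m).t_notMem]

/-- The index of the first letter of the form `t k` in a word. -/
def firstSeparator : List Letter → Option ℕ
  | [] => none
  | t k :: _ => some k
  | _ :: w => firstSeparator w

theorem firstSeparator_append {B : List Letter} (h : ∀ k, t k ∉ B) (k : ℕ) (w : List Letter) :
    firstSeparator (B ++ t k :: w) = some k := by
  induction B with
  | nil => rfl
  | cons y B ih =>
    cases y with
    | t l => exact absurd List.mem_cons_self (h l)
    | _ => exact ih fun l hl => h l (List.mem_cons_of_mem _ hl)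

/-- A factorization of the image of `w` comes from one of `w`, unless it cuts an inserted block. -/
theorem exists_factorization (hb : ∀ k, IsBlock (b k)) {w P Q : List Letter}
    (h : w.flatMap (insertBlocks b s) = P ++ Q) (hQ : ∀ k, firstSeparator Q = some k → ¬ s k) :
    ∃ P' Q', w = P' ++ Q' ∧ P'.flatMap (insertBlocks b s) = P ∧
      Q'.flatMap (insertBlocks b s) = Q := by
  induction w generalizing P with
  | nil =>
    simp only [List.flatMap_nil, List.nil_eq, List.append_eq_nil_iff] at h
    exact ⟨[], [], rfl, h.1.symm, h.2.symm⟩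
  | cons y w ih =>
    rw [List.flatMap_cons] at h
    rcases List.append_eq_append_iff.1 h with ⟨C, hP, hC⟩ | ⟨C, hy, hC⟩
    · obtain ⟨P', Q', rfl, hP', hQ'⟩ := ih hC
      exact ⟨y :: P', Q', rfl, by rw [List.flatMap_cons, hP', hP], hQ'⟩
    · rcases List.eq_nil_or_concat C with rfl | ⟨D, z, rfl⟩
      · exact ⟨[y], w, rfl, by simpa using hy, by simpa using hC.symm⟩
      · by_cases hs : ∃ k, y = t k ∧ s k
        · obtain ⟨k, rfl, hk⟩ := hs
          simp only [insertBlocks, hk, if_true, List.concat_eq_append, ← List.append_assoc] at hy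
          obtain ⟨hD, hz⟩ := List.append_inj' hy rfl
          simp only [List.cons.injEq, and_true] at hz
          subst hz
          refine absurd hk (hQ k ?_)
          rw [hC, List.concat_eq_append, List.append_assoc]
          refine firstSeparator_append (fun l hl => (hb k).t_notMem l ?_) k _
          rw [hD]
          exact List.mem_append_right _ hl
        · have hy' : insertBlocks b s y = [y] := by
            cases y with
            | t k => exact if_neg fun hk => hs ⟨k, rfl, hk⟩
            | _ => rfl
          rw [hy', List.concat_eq_append, ← List.append_assoc] at hy
          have hP : P = [] := by
            rcases P with _ | ⟨c, P⟩
            · rfl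
            · have := congrArg List.length hy
              simp at this
          subst hP
          exact ⟨[], y :: w, rfl, rfl, by rw [List.flatMap_cons, h]; rfl⟩

/-- The indices of the first separators that follow the cuts between the pieces. -/
def cutSeparators : List (List Letter) → List (Option ℕ)
  | [] => []
  | _ :: ps => firstSeparator ps.flatten :: cutSeparators ps

theorem length_cutSeparators (ps : List (List Letter)) :
    (cutSeparators ps).length = ps.length := by
  induction ps with
  | nil => rfl
  | cons _ ps ih => simp [cutSeparators, ih]

/-- If no inserted block is cut, then all pieces of a factorization come from words. -/
theorem exists_pieces (hb : ∀ k, IsBlock (b k)) {w : List Letter} {ps : List (List Letter)}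
    (h : w.flatMap (insertBlocks b s) = ps.flatten) (hs : ∀ k, some k ∈ cutSeparators ps → ¬ s k) :
    ∀ X ∈ ps, ∃ X' : List Letter, X'.flatMap (insertBlocks b s) = X := by
  induction ps generalizing w with
  | nil => simp
  | cons Y ps ih =>
    rw [List.flatten_cons] at h
    obtain ⟨P', Q', rfl, hP', hQ'⟩ := exists_factorization hb h
      fun k hk => hs k (by simp [cutSeparators, hk])
    intro X hX
    rcases List.mem_cons.1 hX with rfl | hX
    · exact ⟨P', hP'⟩
    · exact ih hQ' (fun k hk => hs k (by simp [cutSeparators, hk])) X hX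

end InsertBlocks

/-- Both sides of an identity of `B₂¹` contain the same variables. -/
theorem mem_of_holdsIn_brandtMonoid {P : MonoidIdentity} (h : P.HoldsIn BrandtMonoid) {i : ℕ}
    (hi : i ∈ P.2.toList) : i ∈ P.1.toList := by
  by_contra hn
  let φ : ℕ → BrandtMonoid := fun j => if j = i then BrandtMonoid.zero else 1
  have h₁ : FreeMonoid.lift φ P.1 = 1 := by
    rw [FreeMonoid.lift_apply]
    refine List.prod_eq_one fun y hy => ?_
    obtain ⟨j, hj, rfl⟩ := List.mem_map.1 hy
    exact if_neg (by rintro rfl; exact hn hj)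
  have h₂ : FreeMonoid.lift φ P.2 = BrandtMonoid.zero := by
    rw [FreeMonoid.lift_apply]
    obtain ⟨u, v, huv⟩ := List.append_of_mem hi
    rw [huv]
    simp [φ, BrandtMonoid.zero_mul, BrandtMonoid.mul_zero]
  have h₃ := h φ
  rw [h₁, h₂] at h₃
  have h₄ := congrFun (congrFun (congrArg Subtype.val h₃) 0) 0
  simp [BrandtMonoid.zero] at h₄

/-- Few cuts leave some edge of a long cycle uncut. -/
theorem exists_lt_forall_div_two_ne {l : List (Option ℕ)} {n : ℕ} (h : l.length < n) :
    ∃ i < n, ∀ k, some k ∈ l → k / 2 ≠ i := by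
  by_contra! hc
  have hsub : Finset.range n ⊆ (l.map fun o => o.getD 0 / 2).toFinset := by
    intro i hi
    obtain ⟨k, hk, hki⟩ := hc i (Finset.mem_range.1 hi)
    rw [List.mem_toFinset, List.mem_map]
    exact ⟨some k, hk, hki⟩
  have h₁ := Finset.card_le_card hsub
  have h₂ := List.toFinset_card_le (l.map fun o => o.getD 0 / 2)
  rw [Finset.card_range] at h₁
  rw [List.length_map] at h₂
  omega

/-- The two-colouring of the path that is left of the cycle of length `n` when the edge between `i`
and its successor is removed. -/
def pathColouring (n i j : ℕ) : Bool := decide (Even (if j ≤ i then j + n else j))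

theorem pathColouring_ne {n i j : ℕ} (hi : i < n) (hj : j < n) (hij : j ≠ i) :
    pathColouring n i j ≠ pathColouring n i ((j + 1) % n) := by
  have key : (if (j + 1) % n ≤ i then (j + 1) % n + n else (j + 1) % n) =
      (if j ≤ i then j + n else j) + 1 := by
    rcases Nat.lt_or_ge (j + 1) n with h | h
    · rw [Nat.mod_eq_of_lt h]
      split_ifs <;> omega
    · have : j + 1 = n := by omega
      rw [this, Nat.mod_self]
      split_ifs <;> omega
  unfold pathColouring
  rw [key]
  simp only [ne_eq, decide_eq_decide, Nat.even_add_one]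
  tauto

/-- A short identity of `B₂¹` does not change the word of a long cycle: some edge of the cycle is
not cut by the factorization, and the remaining path has a two-colouring. -/
theorem eq_cycleWord_of_short {n : ℕ} {P : MonoidIdentity} (h : P.HoldsIn BrandtMonoid)
    (hlen : P.1.toList.length + 2 < n) {θ : ℕ → List Letter} {p q : List Letter}
    (hw : p ++ P.1.toList.flatMap θ ++ q = cycleWord n) :
    p ++ P.2.toList.flatMap θ ++ q = cycleWord n := by
  have hn : 2 ≤ n := by omega
  have hb := isBlock_cycleBlock hn
  let ps : List (List Letter) := p :: (P.1.toList.map θ ++ [q])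
  have hps : ps.flatten = cycleWord n := by
    rw [← hw]
    simp [ps, List.flatMap_def]
  obtain ⟨i, hi, hcut⟩ := exists_lt_forall_div_two_ne (l := cutSeparators ps) (n := n) (by
    rw [length_cutSeparators]; simpa [ps] using hlen)
  -- the blocks of the edge between `i` and its successor are deleted
  let s : ℕ → Prop := fun k => k / 2 = i
  let b' : ℕ → List Letter := fun k => if s k then [] else cycleBlock n k
  have hword : (blockWord b' (2 * n + 1)).flatMap (insertBlocks (cycleBlock n) s) = cycleWord n :=
    flatMap_insertBlocks_blockWord hb _
  have hpieces := exists_pieces (w := blockWord b' (2 * n + 1)) hb (hword.trans hps.symm) hcut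
  obtain ⟨p', hp'⟩ := hpieces p (by simp [ps])
  obtain ⟨q', hq'⟩ := hpieces q (by simp [ps])
  have hθ : ∀ z, ∃ X' : List Letter, z ∈ P.1.toList →
      X'.flatMap (insertBlocks (cycleBlock n) s) = θ z := by
    intro z
    by_cases hz : z ∈ P.1.toList
    · obtain ⟨X', hX'⟩ := hpieces (θ z) (by
        simp only [ps, List.mem_cons, List.mem_append, List.mem_map]
        exact Or.inr (Or.inl ⟨z, hz, rfl⟩))
      exact ⟨X', fun _ => hX'⟩
    · exact ⟨[], fun h => absurd h hz⟩
  choose θ' hθ' using hθ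
  have hlift : ∀ u : List ℕ, (∀ z ∈ u, z ∈ P.1.toList) →
      (p' ++ u.flatMap θ' ++ q').flatMap (insertBlocks (cycleBlock n) s) =
        p ++ u.flatMap θ ++ q := by
    intro u hu
    rw [List.flatMap_append, List.flatMap_append, hp', hq', List.flatMap_assoc]
    congr 2
    exact List.flatMap_congr fun z hz => hθ' z (hu z hz)
  have heq : p' ++ P.1.toList.flatMap θ' ++ q' = blockWord b' (2 * n + 1) :=
    flatMap_insertBlocks_injective (b := cycleBlock n) (s := s) (by
      simp only
      rw [hlift _ fun _ hz => hz, hw, hword])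
  have hsame : SameValue BrandtMonoid (blockWord b' (2 * n + 1))
      (p' ++ P.2.toList.flatMap θ' ++ q') := heq ▸ sameValue_of_holdsIn h θ' p' q'
  have hb' : ∀ k, IsBlock (b' k) := by
    intro k
    simp only [b']
    split_ifs
    · exact .nil
    · exact hb k
  have hcol : ∀ k j l, b' k = [a, x j, x l, a] → pathColouring n i j ≠ pathColouring n i l := by
    intro k j l hk
    simp only [b'] at hk
    split_ifs at hk with hs
    unfold cycleBlock at hk
    split_ifs at hk with h₁ h₂
    · simp only [List.cons.injEq, Letter.x.injEq, true_and, and_true] at hk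
      obtain ⟨rfl, rfl⟩ := hk
      exact pathColouring_ne hi (by omega) hs
    · simp only [List.cons.injEq, Letter.x.injEq, true_and, and_true] at hk
      obtain ⟨rfl, rfl⟩ := hk
      exact (pathColouring_ne hi (by omega) hs).symm
    · simp at hk
  have hres := eq_blockWord_of_colouring hb' hcol hsame
  rw [← hlift _ fun _ hz => mem_of_holdsIn_brandtMonoid h hz, hres, hword]

theorem holdsIn_cycleMonoid_of_short {n : ℕ} {P : MonoidIdentity} (h : P.HoldsIn BrandtMonoid)
    (h₁ : P.1.toList.length + 2 < n) (h₂ : P.2.toList.length + 2 < n) :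
    P.HoldsIn (CycleMonoid n) :=
  holdsIn_syntacticCon fun _ _ _ => ⟨eq_cycleWord_of_short h h₁,
    eq_cycleWord_of_short (P := P.swap) (fun θ => (h θ).symm) h₂⟩

/-- The identity of a long cycle holds in the syntactic monoid of the word of a short cycle: an
application in which the variable for `a` is not erased is too long. -/
theorem cycleIdentity_holdsIn_of_long {m n : ℕ} (h : 10 * n + 2 < 4 * m) :
    (cycleIdentity m).HoldsIn (CycleMonoid n) := by
  refine holdsIn_syntacticCon fun θ p q => ?_
  have e : ∀ w : List Letter, (FreeMonoid.ofList (w.map code)).toList.flatMap θ =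
      w.flatMap (θ ∘ code) := by
    intro w
    simp [List.flatMap_map, Function.comp_def]
  simp only [cycleIdentity, e]
  rw [cycleWord_eq m, cycleWordSq]
  by_cases ha : (θ ∘ code) a = []
  · have ha' : θ (code a) = [] := ha
    simp [ha']
  · have hl := le_length_flatMap_blockWord_cycleBlock (n := m) ha le_rfl
    have hn := length_cycleWord n
    constructor <;> intro hw <;> rw [← hw] at hn <;>
      simp only [List.flatMap_append, List.length_append] at hn <;> omega

/-! ### The interval -/

/-- Odd cycle lengths that grow so fast that each identity is short for all later cycles. -/
def cycleLength (k : ℕ) : ℕ := 21 ^ (k + 1)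

theorem odd_cycleLength (k : ℕ) : Odd (cycleLength k) := Odd.pow (by decide)

theorem cycleLength_le {j k : ℕ} (h : j < k) : 21 * cycleLength j ≤ cycleLength k := by
  unfold cycleLength
  calc 21 * 21 ^ (j + 1) = 21 ^ (j + 2) := by ring
    _ ≤ 21 ^ (k + 1) := Nat.pow_le_pow_right (by norm_num) (by omega)

theorem le_cycleLength (k : ℕ) : 21 ≤ cycleLength k := by
  unfold cycleLength
  calc 21 = 21 ^ 1 := by norm_num
    _ ≤ 21 ^ (k + 1) := Nat.pow_le_pow_right (by norm_num) (by omega)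

theorem cycleIdentity_holdsIn_cycleMonoid {j k : ℕ} (h : j ≠ k) :
    (cycleIdentity (cycleLength j)).HoldsIn (CycleMonoid (cycleLength k)) := by
  have := le_cycleLength j
  have := le_cycleLength k
  rcases Nat.lt_or_gt_of_ne h with h | h
  · have := cycleLength_le h
    refine holdsIn_cycleMonoid_of_short (cycleIdentity_holdsIn (odd_cycleLength j)) ?_ ?_
    · simp only [cycleIdentity, FreeMonoid.toList_ofList, List.length_map, length_cycleWord]
      omega
    · simp only [cycleIdentity, FreeMonoid.toList_ofList, List.length_map, length_cycleWordSq]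
      omega
  · have := cycleLength_le h
    exact cycleIdentity_holdsIn_of_long (by omega)

theorem squaresCommute_holdsIn_brandtMonoid : squaresCommute.HoldsIn BrandtMonoid := by
  intro θ
  simpa [squaresCommute] using BrandtMonoid.sq_mul_sq (θ 0) (θ 1)

/-- The subvariety cut out by the identities of the cycles with lengths indexed by `S`. -/
def cycleVariety (S : Set ℕ) : MonoidVariety :=
  MonoidVariety.definedBy ((fun k => cycleIdentity (cycleLength k)) '' S) ⊓
    (MonoidVariety.definedBy {squaresCommute} ⊓ varietyA)

theorem cycleVariety_mem_Icc (S : Set ℕ) :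
    cycleVariety S ∈ Set.Icc varietyB (MonoidVariety.definedBy {squaresCommute} ⊓ varietyA) := by
  refine ⟨le_inf ?_ (le_inf ?_ varietyB_le_varietyA), inf_le_right⟩
  · apply MonoidVariety.generatedBy_le
    rintro _ ⟨k, -, rfl⟩
    exact cycleIdentity_holdsIn (odd_cycleLength k)
  · apply MonoidVariety.generatedBy_le
    rintro _ rfl
    exact squaresCommute_holdsIn_brandtMonoid

theorem cycleMonoid_mem_cycleVariety {S : Set ℕ} {k : ℕ} :
    (cycleVariety S).Mem (CycleMonoid (cycleLength k)) ↔ k ∉ S := by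
  have hk : 2 ≤ cycleLength k := by have := le_cycleLength k; omega
  constructor
  · intro h hkS
    exact cycleIdentity_not_holdsIn _ (h.1 _ ⟨k, hkS, rfl⟩)
  · intro hkS
    refine ⟨?_, ?_, cycleMonoid_mem_varietyA hk⟩
    · rintro _ ⟨j, hj, rfl⟩
      exact cycleIdentity_holdsIn_cycleMonoid (by rintro rfl; exact hkS hj)
    · rintro _ rfl
      exact squaresCommute_holdsIn_cycleMonoid hk

theorem cycleVariety_injective : Function.Injective cycleVariety := by
  intro S T h
  ext k
  rw [← not_iff_not, ← cycleMonoid_mem_cycleVariety, h, cycleMonoid_mem_cycleVariety]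

theorem mk_Icc_eq_continuum :
    #(Set.Icc varietyB (MonoidVariety.definedBy {squaresCommute} ⊓ varietyA)) = 𝔠 := by
  apply le_antisymm
  · exact (Cardinal.mk_subtype_le _).trans MonoidVariety.mk_le_continuum
  · have h := Cardinal.lift_mk_le_lift_mk_of_injective
      (f := fun S : Set ℕ => (⟨cycleVariety S, cycleVariety_mem_Icc S⟩ :
        Set.Icc varietyB (MonoidVariety.definedBy {squaresCommute} ⊓ varietyA)))
      fun S T h => cycleVariety_injective (congrArg Subtype.val h)
    rw [Cardinal.mk_set, Cardinal.mk_nat, Cardinal.two_power_aleph0, Cardinal.lift_continuum,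
      Cardinal.lift_uzero] at h
    exact h

/-- A finite set of identities of `B₂¹` holds in the syntactic monoid of the word of a long odd
cycle, which lies in the variety of `A₂¹` but not in that of `B₂¹`. -/
theorem definedBy_inf_varietyA_ne {Γ : Set MonoidIdentity} (hΓ : Γ.Finite) :
    MonoidVariety.definedBy Γ ⊓ varietyA ≠ varietyB := by
  intro h
  have hB : ∀ P ∈ Γ, P.HoldsIn BrandtMonoid := by
    have : varietyB.Mem BrandtMonoid := MonoidVariety.mem_generatedBy_self _
    rw [← h] at this
    exact this.1
  obtain ⟨N, hN⟩ : ∃ N, ∀ P ∈ Γ, P.1.toList.length + P.2.toList.length ≤ N := by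
    obtain ⟨N, hN⟩ := (hΓ.image fun P => P.1.toList.length + P.2.toList.length).bddAbove
    exact ⟨N, fun P hP => hN ⟨P, hP, rfl⟩⟩
  let n := 2 * N + 3
  have hn : Odd n := ⟨N + 1, by simp only [n]; ring⟩
  have hmem : (MonoidVariety.definedBy Γ ⊓ varietyA).Mem (CycleMonoid n) := by
    refine ⟨fun P hP => ?_, cycleMonoid_mem_varietyA (by simp only [n]; omega)⟩
    have := hN P hP
    exact holdsIn_cycleMonoid_of_short (hB P hP) (by simp only [n]; omega)
      (by simp only [n]; omega)
  rw [h] at hmem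
  exact cycleIdentity_not_holdsIn n
    (MonoidVariety.holdsIn_of_mem_generatedBy hmem (cycleIdentity_holdsIn hn))

theorem mainTheorem1 :
    #(Set.Icc varietyB (MonoidVariety.definedBy {squaresCommute} ⊓ varietyA)) = 𝔠 ∧
    ¬ ∃ Γ : Set MonoidIdentity, Γ.Finite ∧
      MonoidVariety.definedBy Γ ⊓ varietyA = varietyB := by
  refine ⟨mk_Icc_eq_continuum, ?_⟩
  rintro ⟨Γ, hΓ, h⟩
  exact definedBy_inf_varietyA_ne hΓ h
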